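/- Let $F_1,F_2\in\mathbb{C}[X,Y,Z]$ be homogeneous polynomials of the same degree $n\ge 1$ without common factor of positive degree, let $\mathcal{L}=\{\alpha F_1+\beta F_2=0 \mid (\alpha:\beta)\in\mathbb{CP}^1\}$ be the pencil of plane curves that they span, and let $\mathcal{X}_{\mathcal L}$ be the vector field on $\mathbb{CP}^2$ defined by the homogeneous 1-form $A\,dX+B\,dY+C\,dZ$ obtained from $F_2\,dF_1-F_1\,dF_2$ by dividing its three coefficients by their greatest common divisor. *Infinitely near points.* A point is either a point of $\mathbb{CP}^2$ or a point of the exceptional divisor $E_Q$ created by blowing up a point $Q$ obtained before; a point is infinitely near to itself, and a point of $E_Q$ is infinitely near to every point to which $Q$ is infinitely near. A configuration is a finite set of such points that contains $Q$ whenever it contains a point of $E_Q$. *Base points.* $\mathcal{BP}(\mathcal L)$ is the set of all points, proper or infinitely near, through which the strict transforms of all but finitely many curves of $\mathcal L$ (the generic curves) pass. For such a point $P$ let $m_P$ be the common multiplicity at $P$ of the strict transforms of the generic curves. The virtual transform at $P$ of a curve of $\mathcal L$ has a local equation obtained from one of the curve by pulling back, at each successive blow-up of a point $Q$ preceding $P$,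 and dividing by the $m_Q$-th power of an equation of $E_Q$. Let $f_1,f_2$ be the local equations of the virtual transforms of $F_1,F_2$ at $P$ and $D$ the greatest common divisor of their homogeneous components of degree $m_P$. The point $P$ is dicritical with respect to $\mathcal L$ if $m_P-\deg D>0$. *Dicritical configuration.* Let a vector field be given in local coordinates by $\omega=p\,dy-q\,dx$ with isolated singularities, let $m$ be the degree of the first non-zero jet of $\omega$ at the origin, and $p_m,q_m$ the homogeneous components of degree $m$ of $p,q$. A singularity at the origin is dicritical if $yp_m-xq_m\equiv 0$. The strict transform of $\omega$ under the blow-up of the origin is the pull-back of $\omega$ divided by the $(m+1)$-st power of an equation of the exceptional divisor if $yp_m-xq_m\equiv0$, and by the $m$-th power otherwise. A singularity is simple if $m=1$ and the eigenvalues $\lambda_1,\lambda_2$ of the linear part of $p\,\partial_x+q\,\partial_y$ satisfy either $\lambda_1\lambda_2\neq0$ and $\lambda_1/\lambda_2\notin\mathbb{Q}^{+}$, or $\lambda_1\lambda_2=0$ and $\lambda_1^2+\lambda_2^2\neq 0$; a singularity that is not simple is ordinary. For a vector field $\mathcal X$ on $\mathbb{CP}^2$, $\mathcal S(\mathcal X)$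 is the set of points $Q$ that are infinitely near to some ordinary singularity of $\mathcal X$ in $\mathbb{CP}^2$ and at which the strict transform of $\mathcal X$ has an ordinary singularity; $\mathcal D(\mathcal X)$ is the set of $P\in\mathcal S(\mathcal X)$ to which some $Q\in\mathcal S(\mathcal X)$ is infinitely near such that the strict transform of $\mathcal X$ has a dicritical singularity at $Q$. The infinitely near dicritical singularities of $\mathcal X$ are the points of $\mathcal D(\mathcal X)$ at which the strict transform of $\mathcal X$ has a dicritical singularity. **Statement.** The set $\mathcal{BP}(\mathcal L)$ is a configuration (in particular it is finite), and $$\mathcal{BP}(\mathcal L)=\mathcal D(\mathcal X_{\mathcal L}).$$ Moreover, a point $P\in\mathcal{BP}(\mathcal L)$ is dicritical with respect to $\mathcal L$ if and only if it is an infinitely near dicritical singularity of $\mathcal X_{\mathcal L}$. -/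

import Mathlib

namespace InfNear

noncomputable section

open MvPolynomial Filter

/-- The complex projective plane, with homogeneous coordinates `X = X 0`, `Y = X 1`, `Z = X 2`. -/
abbrev CP2 : Type := Projectivization ℂ (Fin 3 → ℂ)

/-- The complex projective line. -/
abbrev CP1 : Type := Projectivization ℂ (Fin 2 → ℂ)

/-- Polynomials in local coordinates `(x, y) = (X 0, X 1)`. -/
abbrev LocalPoly : Type := MvPolynomial (Fin 2) ℂ

/-- Polynomial 1-forms `ω 0 dx + ω 1 dy` in local coordinates. The form `p dy - q dx` is the one
attached to the vector field `p ∂/∂x + q ∂/∂y`. -/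
abbrev LocalForm : Type := Fin 2 → LocalPoly

/-- Homogeneous 1-forms `Ω 0 dX + Ω 1 dY + Ω 2 dZ`. -/
abbrev HomForm : Type := Fin 3 → MvPolynomial (Fin 3) ℂ

/-- A greatest common divisor of two polynomials (unique up to a non-zero constant). -/
def pgcd {σ : Type} (f g : MvPolynomial σ ℂ) : MvPolynomial σ ℂ :=
  letI : GCDMonoid (MvPolynomial σ ℂ) := UniqueFactorizationMonoid.toGCDMonoid _
  gcd f g

theorem pgcd_dvd_left {σ : Type} (f g : MvPolynomial σ ℂ) : pgcd f g ∣ f :=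
  letI : GCDMonoid (MvPolynomial σ ℂ) := UniqueFactorizationMonoid.toGCDMonoid _
  gcd_dvd_left f g

theorem pgcd_dvd_right {σ : Type} (f g : MvPolynomial σ ℂ) : pgcd f g ∣ g :=
  letI : GCDMonoid (MvPolynomial σ ℂ) := UniqueFactorizationMonoid.toGCDMonoid _
  gcd_dvd_right f g

theorem dvd_pgcd {σ : Type} {f g h : MvPolynomial σ ℂ} (hf : h ∣ f) (hg : h ∣ g) :
    h ∣ pgcd f g :=
  letI : GCDMonoid (MvPolynomial σ ℂ) := UniqueFactorizationMonoid.toGCDMonoid _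
  dvd_gcd hf hg

/-! ### Infinitely near points of the projective plane -/

/-- Points of `ℂℙ²` and points infinitely near to them. Every infinitely near point carries the
local coordinates `(x, y)` centred at it which are fixed by `chartIndex` and `dehomogenize`
(proper points) and by `blowUpMap` (points on exceptional divisors). With respect to the
coordinates at `Q`, the exceptional divisor `E_Q`, that is the projectivization of the tangent
space at `Q`, is `CP1`, and `near Q [α : β]` is the point `[α ∂/∂x + β ∂/∂y]` of `E_Q`. -/
inductive Point : Type
  | proper (P : CP2) : Point
  | near (Q : Point) (d : CP1) : Point

/-- `IsInfNear P Q`: the point `Q` is infinitely near to `P` (every point is infinitely near to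
itself). -/
inductive IsInfNear (P : Point) : Point → Prop
  | refl : IsInfNear P P
  | step (Q : Point) (d : CP1) : IsInfNear P Q → IsInfNear P (Point.near Q d)

/-- A configuration of infinitely near points of `ℂℙ²`: a finite set of points which, with a point
on an exceptional divisor `E_Q`, contains the blown-up point `Q`. -/
def IsConfiguration (S : Set Point) : Prop :=
  S.Finite ∧ ∀ (Q : Point) (d : CP1), Point.near Q d ∈ S → Q ∈ S

/-! ### Local coordinates -/

open scoped Classical in
/-- The affine chart used at a point of the plane: `Z = 1` if `Z ≠ 0`, otherwise `Y = 1` if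
`Y ≠ 0`, otherwise `X = 1`. -/
def chartIndex (P : CP2) : Fin 3 :=
  if P.rep 2 ≠ 0 then 2 else if P.rep 1 ≠ 0 then 1 else 0

/-- The expression of a homogeneous polynomial in the affine chart at `P`, in the affine
coordinates translated so that `P` becomes the origin. -/
def dehomogenize (P : CP2) (F : MvPolynomial (Fin 3) ℂ) : LocalPoly :=
  bind₁ ((chartIndex P).insertNth (α := fun _ => LocalPoly) 1
    (fun j => X j + C (P.rep ((chartIndex P).succAbove j) / P.rep (chartIndex P)))) F

open scoped Classical in
/-- The blow-up of the origin in coordinates centred at the point `d = [α : β]` of the exceptional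
divisor: if `α ≠ 0` it is `(x, t) ↦ (x, x (t + β / α))`, otherwise `(s, y) ↦ (s y, y)`. -/
def blowUpMap (d : CP1) : Fin 2 → LocalPoly :=
  if d.rep 0 ≠ 0 then ![X 0, X 0 * (X 1 + C (d.rep 1 / d.rep 0))] else ![X 0 * X 1, X 1]

open scoped Classical in
/-- The index of the coordinate whose vanishing defines the exceptional divisor in the chart used
at the point `d` of it. -/
def excIndex (d : CP1) : Fin 2 := if d.rep 0 ≠ 0 then 0 else 1

/-- Division by the `k`-th power of the local equation of the exceptional divisor. -/
def divExc (d : CP1) (k : ℕ) (f : LocalPoly) : LocalPoly :=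
  f.divMonomial (Finsupp.single (excIndex d) k)

/-- The multiplicity at the origin: the degree of the first non-zero jet. -/
def mult (f : LocalPoly) : ℕ := sInf {k | homogeneousComponent k f ≠ 0}

/-! ### Curves: strict transforms, base points of a pencil -/

/-- Local equation at a point of the strict transform of the curve `F = 0`. -/
def strictCurve (F : MvPolynomial (Fin 3) ℂ) : Point → LocalPoly
  | .proper P => dehomogenize P F
  | .near Q d => divExc d (mult (strictCurve F Q)) (bind₁ (blowUpMap d) (strictCurve F Q))

/-- The member with parameter `(α : β)` of the pencil spanned by `F₁` and `F₂`; an equation of it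
is `α F₁ + β F₂ = 0`. -/
def member (F₁ F₂ : MvPolynomial (Fin 3) ℂ) (p : CP1) : MvPolynomial (Fin 3) ℂ :=
  C (p.rep 0) * F₁ + C (p.rep 1) * F₂

/-- The configuration of base points of the pencil: all points, proper or infinitely near, through
which the strict transforms of the generic members (all but finitely many) pass. -/
def basePoints (F₁ F₂ : MvPolynomial (Fin 3) ℂ) : Set Point :=
  {Q | ∀ᶠ p : CP1 in cofinite, constantCoeff (strictCurve (member F₁ F₂ p) Q) = 0}

/-- The multiplicity of the pencil at a point: the common multiplicity of the strict transforms of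
the generic members. -/
def pencilMult (F₁ F₂ : MvPolynomial (Fin 3) ℂ) (Q : Point) : ℕ :=
  Classical.epsilon fun m : ℕ =>
    ∀ᶠ p : CP1 in cofinite, mult (strictCurve (member F₁ F₂ p) Q) = m

/-- Local equation at a point of the virtual transform of the curve `F = 0` with respect to the
points preceding it, taken with the multiplicities of the pencil. -/
def virtualCurve (F₁ F₂ : MvPolynomial (Fin 3) ℂ) (F : MvPolynomial (Fin 3) ℂ) :
    Point → LocalPoly
  | .proper P => dehomogenize P F
  | .near Q d => divExc d (pencilMult F₁ F₂ Q) (bind₁ (blowUpMap d) (virtualCurve F₁ F₂ F Q))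

/-- A point `P` is dicritical with respect to the pencil if `m - deg D > 0`, where `m` is the
multiplicity of the pencil at `P` and `D` is the greatest common divisor of the homogeneous
components of degree `m` of the virtual transforms of `F₁` and `F₂` at `P`. -/
def IsPencilDicritical (F₁ F₂ : MvPolynomial (Fin 3) ℂ) (P : Point) : Prop :=
  (pgcd (homogeneousComponent (pencilMult F₁ F₂ P) (virtualCurve F₁ F₂ F₁ P))
    (homogeneousComponent (pencilMult F₁ F₂ P) (virtualCurve F₁ F₂ F₂ P))).totalDegree
      < pencilMult F₁ F₂ P

/-! ### Vector fields: strict transforms, dicritical configuration -/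

/-- The multiplicity at the origin of a 1-form: the degree of its first non-zero jet. -/
def formMult (ω : LocalForm) : ℕ := sInf {k | ∃ i, homogeneousComponent k (ω i) ≠ 0}

/-- The characteristic polynomial `x a_m + y b_m` of `a dx + b dy`, which has multiplicity `m`;
for `p dy - q dx` it is `y p_m - x q_m`. -/
def charPoly (ω : LocalForm) : LocalPoly :=
  X 0 * homogeneousComponent (formMult ω) (ω 0) + X 1 * homogeneousComponent (formMult ω) (ω 1)

/-- The pull-back of a 1-form by a polynomial map. -/
def pullback (φ : Fin 2 → LocalPoly) (ω : LocalForm) : LocalForm :=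
  fun j => ∑ i, bind₁ φ (ω i) * pderiv j (φ i)

open scoped Classical in
/-- The strict transform of a 1-form of multiplicity `m` by the blow-up of the origin, in the
coordinates at the point `d` of the exceptional divisor: the total transform divided by the
`(m + 1)`-st power of the equation of the exceptional divisor if the characteristic polynomial
vanishes identically, and by its `m`-th power otherwise. -/
def blowUpForm (d : CP1) (ω : LocalForm) : LocalForm :=
  fun j => divExc d (if charPoly ω = 0 then formMult ω + 1 else formMult ω)
    (pullback (blowUpMap d) ω j)

/-- The strict transform, at a point, of the vector field on `ℂℙ²` given by a homogeneous 1-form.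
At a proper point the homogeneous coordinate which is set equal to `1` has differential `0`. -/
def strictForm (Ω : HomForm) : Point → LocalForm
  | .proper P => fun j => dehomogenize P (Ω ((chartIndex P).succAbove j))
  | .near Q d => blowUpForm d (strictForm Ω Q)

/-- The origin is a singularity. -/
def IsSingular (ω : LocalForm) : Prop := ∀ i, constantCoeff (ω i) = 0

/-- The origin is a dicritical singularity. -/
def IsDicritical (ω : LocalForm) : Prop := IsSingular ω ∧ charPoly ω = 0

/-- The matrix of the linear part at the origin of the vector field `p ∂/∂x + q ∂/∂y`, where
`p = ω 1` and `q = - ω 0`. -/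
def linearPart (ω : LocalForm) : Matrix (Fin 2) (Fin 2) ℂ :=
  fun i j => coeff (Finsupp.single j 1) ((![ω 1, -ω 0] : Fin 2 → LocalPoly) i)

/-- The origin is a simple singularity. -/
def IsSimple (ω : LocalForm) : Prop :=
  IsSingular ω ∧ formMult ω = 1 ∧ ∃ l₁ l₂ : ℂ, (linearPart ω).charpoly.roots = {l₁, l₂} ∧
    ((l₁ * l₂ ≠ 0 ∧ ¬ ∃ q : ℚ, 0 < q ∧ l₁ / l₂ = (q : ℂ)) ∨
      (l₁ * l₂ = 0 ∧ l₁ ^ 2 + l₂ ^ 2 ≠ 0))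

/-- The origin is an ordinary singularity. -/
def IsOrdinary (ω : LocalForm) : Prop := IsSingular ω ∧ ¬ IsSimple ω

/-- The singular configuration of a vector field on `ℂℙ²`. -/
def singularConfiguration (Ω : HomForm) : Set Point :=
  {Q | IsOrdinary (strictForm Ω Q) ∧
    ∃ P : CP2, IsOrdinary (strictForm Ω (.proper P)) ∧ IsInfNear (.proper P) Q}

/-- The dicritical configuration of a vector field on `ℂℙ²`. -/
def dicriticalConfiguration (Ω : HomForm) : Set Point :=
  {P | P ∈ singularConfiguration Ω ∧
    ∃ Q ∈ singularConfiguration Ω, IsInfNear P Q ∧ IsDicritical (strictForm Ω Q)}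

/-- The infinitely near dicritical singularities of a vector field on `ℂℙ²`. -/
def dicriticalSingularities (Ω : HomForm) : Set Point :=
  {Q | Q ∈ dicriticalConfiguration Ω ∧ IsDicritical (strictForm Ω Q)}

/-! ### The vector field of a pencil -/

/-- The form `F₂ dF₁ - F₁ dF₂`. -/
def wronskianForm (F₁ F₂ : MvPolynomial (Fin 3) ℂ) : HomForm :=
  fun i => F₂ * pderiv i F₁ - F₁ * pderiv i F₂

/-- The greatest common divisor of the three coefficients of a homogeneous form. -/
def content (Ω : HomForm) : MvPolynomial (Fin 3) ℂ := pgcd (Ω 0) (pgcd (Ω 1) (Ω 2))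

theorem content_dvd (Ω : HomForm) (i : Fin 3) : content Ω ∣ Ω i := by
  fin_cases i
  · exact pgcd_dvd_left _ _
  · exact (pgcd_dvd_right _ _).trans (pgcd_dvd_left _ _)
  · exact (pgcd_dvd_right _ _).trans (pgcd_dvd_right _ _)

/-- The 1-form `(F₂ dF₁ - F₁ dF₂) / gcd` which defines the vector field of the pencil; its `i`-th
coefficient is the quotient by the greatest common divisor of all three coefficients. -/
def pencilForm (F₁ F₂ : MvPolynomial (Fin 3) ℂ) : HomForm :=
  fun i => Classical.choose (content_dvd (wronskianForm F₁ F₂) i)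

theorem wronskianForm_eq (F₁ F₂ : MvPolynomial (Fin 3) ℂ) (i : Fin 3) :
    wronskianForm F₁ F₂ i = content (wronskianForm F₁ F₂) * pencilForm F₁ F₂ i :=
  Classical.choose_spec (content_dvd (wronskianForm F₁ F₂) i)

end

end InfNear

/-! At a point `Q` let `f`, `g` be the virtual transforms of the two generators, `m` the smaller of
their orders, `f_m`, `g_m` their components of degree `m`, and `ω` the strict transform of the
vector field. Four properties pass from `Q` to every point of `E_Q` (`IsAdapted`, `IsAdapted.near`):
`f`, `g` are linearly independent over `ℂ`; `g df - f dg` is a multiple of `ω`; `ℂ[x, y]/(f, g)` has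
finite dimension; the strict transforms of the generic members are the `α f + β g`. Consequently `m`
is the multiplicity of the pencil at `Q`, `Q` is a base point iff `m > 0`, and the base points on
`E_Q` are the common zeros of `f_m` and `g_m`, finite in number.

Termination. Noether's inequality `colength_transform_add_le`: blowing up `Q` lowers `dim ℂ[x,
y]/(f, g)` by at least `m ^ 2`. The colength is taken in the whole affine chart, so no local ring is
needed. Elimination gives its finiteness at proper points and the finiteness of the set of proper
base points. Induction on the colength then makes the set of base points finite.

Dicriticalness. The contraction of `g df - f dg` with the Euler field is `g E(f) - f E(g)`, whose
leading term for orders `a`, `b` is `(a - b) f_a g_b`. If `f_m`, `g_m` are independent, this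
vanishes in degree `2 m` while the form has order exactly `2 m - 1`, so `ω` is dicritical. If they
are proportional, some combination has order greater than `m`, the factor `a - b` is non-zero and
`ω` is not dicritical. Independence of `f_m`, `g_m` also means that their gcd has degree less than
`m`. Hence both notions of dicritical point agree (`IsAdapted.charPoly_eq_zero_iff`), and a
dicritical point has `m > 0`, so it is a base point, as are all points preceding it.

Conversely, at a non-dicritical base point the proportional forms `f_m`, `g_m` have a common zero,
which is a base point on `E_Q` of smaller colength; so every base point precedes a dicritical one.
Non-ordinary points stay non-ordinary under blowing up (`not_isOrdinary_blowUpForm`) and dicritical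
singularities are ordinary, so all points preceding a dicritical one are ordinary singularities.
This gives the equality of the two configurations. -/

namespace InfNear

noncomputable section

open MvPolynomial Filter

/-! ### Orders and homogeneous components -/

/-- The polynomials of multiplicity at least `k` at the origin. -/
def ord (k : ℕ) : Submodule ℂ LocalPoly where
  carrier := {f | ∀ j < k, homogeneousComponent j f = 0}
  add_mem' := fun hf hg j hj => by rw [map_add, hf j hj, hg j hj, add_zero]
  zero_mem' := fun j _ => map_zero _
  smul_mem' := fun c f hf j hj => by rw [map_smul, hf j hj, smul_zero]

theorem mem_ord {k : ℕ} {f : LocalPoly} :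
    f ∈ ord k ↔ ∀ j < k, homogeneousComponent j f = 0 := Iff.rfl

theorem ord_anti {j k : ℕ} (h : j ≤ k) : ord k ≤ ord j :=
  fun _ hf i hi => hf i (hi.trans_le h)

theorem mem_ord_zero (f : LocalPoly) : f ∈ ord 0 := fun _ h => absurd h (Nat.not_lt_zero _)

theorem mem_ord_succ {k : ℕ} {f : LocalPoly} (hf : f ∈ ord k)
    (h : homogeneousComponent k f = 0) : f ∈ ord (k + 1) := by
  intro j hj
  rcases Nat.lt_succ_iff_lt_or_eq.1 hj with h' | rfl
  · exact hf j h'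
  · exact h

theorem exists_homogeneousComponent_ne_zero {f : LocalPoly} (hf : f ≠ 0) :
    ∃ k, homogeneousComponent k f ≠ 0 := by
  by_contra! h
  exact hf (by rw [← sum_homogeneousComponent f]; exact Finset.sum_eq_zero fun i _ => h i)

/-- Valid for `f = 0` too, where `mult` has the default value `0` of an infimum over the empty set.
-/
theorem mem_ord_mult (f : LocalPoly) : f ∈ ord (mult f) := fun j hj => by
  by_contra h
  exact Nat.notMem_of_lt_sInf hj h

theorem homogeneousComponent_mult_ne_zero {f : LocalPoly} (hf : f ≠ 0) :
    homogeneousComponent (mult f) f ≠ 0 :=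
  Nat.sInf_mem (s := {k | homogeneousComponent k f ≠ 0}) (exists_homogeneousComponent_ne_zero hf)

theorem mult_eq {f : LocalPoly} {k : ℕ} (hf : f ∈ ord k) (h : homogeneousComponent k f ≠ 0) :
    mult f = k := by
  refine le_antisymm (Nat.sInf_le h) (le_of_not_gt fun hlt => ?_)
  refine homogeneousComponent_mult_ne_zero (f := f) ?_ (hf _ hlt)
  rintro rfl
  exact h (map_zero _)

/-- The ring homomorphism `f(x, y) ↦ f(s x, s y)`. -/
def dilate : LocalPoly →ₐ[ℂ] Polynomial LocalPoly :=
  aeval fun i => Polynomial.C (X i) * Polynomial.X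

/-- With homogeneous components read as coefficients in the dilation parameter, their product rule
becomes that of univariate polynomials. -/
theorem coeff_dilate (f : LocalPoly) (k : ℕ) :
    (dilate f).coeff k = homogeneousComponent k f := by
  induction f using MvPolynomial.induction_on' with
  | add p q hp hq => rw [map_add, map_add, Polynomial.coeff_add, hp, hq]
  | monomial d a =>
    have h : dilate (monomial d a) =
        Polynomial.C (monomial d a) * Polynomial.X ^ d.degree := by
      rw [dilate, aeval_monomial, monomial_eq, Finsupp.degree_eq_sum, Finsupp.prod_fintype _ _ (by simp),
        Finsupp.prod_fintype _ _ (by simp)]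
      simp only [mul_pow, Finset.prod_mul_distrib, Finset.prod_pow_eq_pow_sum, map_mul, map_prod,
        map_pow, mul_assoc]
      rfl
    rw [h, Polynomial.coeff_C_mul_X_pow,
      homogeneousComponent_of_mem (isHomogeneous_monomial a rfl)]

theorem homogeneousComponent_mul (f g : LocalPoly) (k : ℕ) :
    homogeneousComponent k (f * g) = ∑ p ∈ Finset.HasAntidiagonal.antidiagonal k,
      homogeneousComponent p.1 f * homogeneousComponent p.2 g := by
  rw [← coeff_dilate, map_mul, Polynomial.coeff_mul]
  simp only [coeff_dilate]

theorem mul_mem_ord {a b : ℕ} {f g : LocalPoly} (hf : f ∈ ord a) (hg : g ∈ ord b) :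
    f * g ∈ ord (a + b) := by
  intro j hj
  rw [homogeneousComponent_mul]
  refine Finset.sum_eq_zero fun p hp => ?_
  rw [Finset.HasAntidiagonal.mem_antidiagonal] at hp
  by_cases h : p.1 < a
  · rw [hf _ h, zero_mul]
  · rw [hg _ (by omega), mul_zero]

theorem homogeneousComponent_mul_of_mem_ord {a b : ℕ} {f g : LocalPoly} (hf : f ∈ ord a)
    (hg : g ∈ ord b) : homogeneousComponent (a + b) (f * g) =
      homogeneousComponent a f * homogeneousComponent b g := by
  rw [homogeneousComponent_mul]
  refine Finset.sum_eq_single_of_mem (a, b) (by simp) fun p hp hne => ?_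
  rw [Finset.HasAntidiagonal.mem_antidiagonal] at hp
  by_cases h : p.1 < a
  · rw [hf _ h, zero_mul]
  · by_cases h' : p.2 < b
    · rw [hg _ h', mul_zero]
    · exact absurd (Prod.ext (by simp; omega) (by simp; omega)) hne

theorem mem_ord_of_mul_mem_ord {a b : ℕ} {f g : LocalPoly} (hf : f ∈ ord a)
    (ha : homogeneousComponent a f ≠ 0) (h : f * g ∈ ord (a + b)) : g ∈ ord b := by
  by_contra hg
  have h0 : g ≠ 0 := by rintro rfl; exact hg (zero_mem _)
  have hlt : mult g < b := by
    by_contra hle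
    exact hg (ord_anti (not_lt.1 hle) (mem_ord_mult g))
  have := homogeneousComponent_mul_of_mem_ord hf (mem_ord_mult g)
  rw [h _ (by omega)] at this
  exact mul_ne_zero ha (homogeneousComponent_mult_ne_zero h0) this.symm

theorem X_mem_ord (i : Fin 2) : (X i : LocalPoly) ∈ ord 1 := fun j hj => by
  rw [homogeneousComponent_of_mem (isHomogeneous_X ℂ i), if_neg (by omega)]

theorem homogeneousComponent_X_mul (i : Fin 2) (f : LocalPoly) (k : ℕ) :
    homogeneousComponent (k + 1) (X i * f) = X i * homogeneousComponent k f := by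
  rw [← coeff_dilate, map_mul, dilate, aeval_X, mul_assoc, Polynomial.coeff_C_mul, mul_comm,
    Polynomial.coeff_X_mul, ← dilate, coeff_dilate, mul_comm]

theorem homogeneousComponent_pderiv (i : Fin 2) (f : LocalPoly) (k : ℕ) :
    homogeneousComponent k (pderiv i f) = pderiv i (homogeneousComponent (k + 1) f) := by
  ext d
  rw [coeff_homogeneousComponent, coeff_pderiv, coeff_pderiv, coeff_homogeneousComponent]
  simp only [map_add, Finsupp.degree_single, add_left_inj]
  split_ifs <;> simp

theorem pderiv_mem_ord {i : Fin 2} {f : LocalPoly} {k : ℕ} (hf : f ∈ ord k) :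
    pderiv i f ∈ ord (k - 1) := fun j hj => by
  rw [homogeneousComponent_pderiv, hf _ (by omega), map_zero]

/-- The Euler vector field applied to a polynomial. -/
def euler (f : LocalPoly) : LocalPoly := X 0 * pderiv 0 f + X 1 * pderiv 1 f

theorem homogeneousComponent_euler (f : LocalPoly) (k : ℕ) :
    homogeneousComponent k (euler f) = k • homogeneousComponent k f := by
  cases k with
  | zero =>
    have h : euler f ∈ ord 1 := add_mem
      (ord_anti (by omega) (mul_mem_ord (X_mem_ord 0) (mem_ord_zero _)))
      (ord_anti (by omega) (mul_mem_ord (X_mem_ord 1) (mem_ord_zero _)))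
    rw [h 0 one_pos, zero_smul]
  | succ k =>
    rw [euler, map_add, homogeneousComponent_X_mul, homogeneousComponent_X_mul,
      homogeneousComponent_pderiv, homogeneousComponent_pderiv,
      ← (homogeneousComponent_isHomogeneous (k + 1) f).sum_X_mul_pderiv, Fin.sum_univ_two]

theorem euler_mem_ord {f : LocalPoly} {k : ℕ} (hf : f ∈ ord k) : euler f ∈ ord k :=
  fun j hj => by rw [homogeneousComponent_euler, hf j hj, smul_zero]

theorem homogeneousComponent_zero_eq_zero_iff {f : LocalPoly} :
    homogeneousComponent 0 f = 0 ↔ constantCoeff f = 0 := by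
  rw [homogeneousComponent_zero, C_eq_zero]; rfl

theorem constantCoeff_eq_zero_of_mem_ord {f : LocalPoly} {k : ℕ} (hf : f ∈ ord (k + 1)) :
    constantCoeff f = 0 :=
  homogeneousComponent_zero_eq_zero_iff.1 (hf 0 (Nat.succ_pos _))

/-! ### The blow-up of the origin -/

/-- The local equation of the exceptional divisor. -/
def exc (d : CP1) : LocalPoly := X (excIndex d)

theorem exc_ne_zero (d : CP1) : exc d ≠ 0 := X_ne_zero _

theorem constantCoeff_exc (d : CP1) : constantCoeff (exc d) = 0 := constantCoeff_X ℂ _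

open scoped Classical in
/-- The quotients of the components of the blow-up map by the equation of the exceptional
divisor. -/
def dirMap (d : CP1) : Fin 2 → LocalPoly :=
  if d.rep 0 ≠ 0 then ![1, X 1 + C (d.rep 1 / d.rep 0)] else ![X 0, 1]

theorem blowUpMap_eq (d : CP1) (i : Fin 2) : blowUpMap d i = exc d * dirMap d i := by
  unfold blowUpMap exc excIndex dirMap
  split_ifs <;> fin_cases i <;> simp [mul_comm]

theorem rep_one_ne_zero {d : CP1} (h : d.rep 0 = 0) : d.rep 1 ≠ 0 := fun h1 =>
  d.rep_nonzero (by ext i; fin_cases i <;> simp [h, h1])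

theorem rep_excIndex_ne_zero (d : CP1) : d.rep (excIndex d) ≠ 0 := by
  unfold excIndex
  split_ifs with h
  · exact h
  · exact rep_one_ne_zero (not_not.1 h)

theorem rep_eq_smul_dirMap (d : CP1) (i : Fin 2) :
    d.rep i = d.rep (excIndex d) * constantCoeff (dirMap d i) := by
  unfold dirMap excIndex
  split_ifs with h
  · fin_cases i <;> simp; field_simp
  · fin_cases i <;> simp; exact not_not.1 h

/-- The pull-back of polynomials by the blow-up of the origin. -/
def blowUpHom (d : CP1) : LocalPoly →ₐ[ℂ] LocalPoly := bind₁ (blowUpMap d)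

theorem bind₁_mul_of_isHomogeneous {σ τ : Type} {f : MvPolynomial σ ℂ} {k : ℕ}
    (hf : f.IsHomogeneous k) (e : MvPolynomial τ ℂ) (u : σ → MvPolynomial τ ℂ) :
    bind₁ (fun i => e * u i) f = e ^ k * bind₁ u f := by
  rw [← aeval_eq_bind₁, ← aeval_eq_bind₁, aeval_def, aeval_def, eval₂_eq, eval₂_eq,
    Finset.mul_sum]
  refine Finset.sum_congr rfl fun d hd => ?_
  rw [hf.degree_eq_sum_deg_support hd]
  simp only [mul_pow, Finset.prod_mul_distrib, Finset.prod_pow_eq_pow_sum]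
  ring

theorem blowUpHom_of_isHomogeneous (d : CP1) {f : LocalPoly} {k : ℕ} (hf : f.IsHomogeneous k) :
    blowUpHom d f = exc d ^ k * bind₁ (dirMap d) f := by
  rw [← bind₁_mul_of_isHomogeneous hf, blowUpHom]
  congr 2
  exact funext fun i => blowUpMap_eq d i

theorem exc_pow_dvd_blowUpHom (d : CP1) {f : LocalPoly} {k : ℕ} (hf : f ∈ ord k) :
    exc d ^ k ∣ blowUpHom d f := by
  rw [← sum_homogeneousComponent f, map_sum]
  refine Finset.dvd_sum fun j _ => ?_
  by_cases h : j < k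
  · rw [hf j h, map_zero]; exact dvd_zero _
  · rw [blowUpHom_of_isHomogeneous d (homogeneousComponent_isHomogeneous j f)]
    exact dvd_mul_of_dvd_left (pow_dvd_pow _ (not_lt.1 h)) _

theorem exists_blowUpHom_eq (d : CP1) {f : LocalPoly} {k : ℕ} (hf : f ∈ ord k) :
    ∃ g, blowUpHom d f =
      exc d ^ k * (bind₁ (dirMap d) (homogeneousComponent k f) + exc d * g) := by
  have h : f - homogeneousComponent k f ∈ ord (k + 1) := by
    intro j hj
    rw [map_sub, homogeneousComponent_of_mem (homogeneousComponent_isHomogeneous k f)]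
    rcases Nat.lt_succ_iff_lt_or_eq.1 hj with h | rfl
    · rw [if_neg h.ne, hf j h, sub_zero]
    · rw [if_pos rfl, sub_self]
  obtain ⟨g, hg⟩ := exc_pow_dvd_blowUpHom d h
  refine ⟨g, ?_⟩
  rw [mul_add, ← blowUpHom_of_isHomogeneous d (homogeneousComponent_isHomogeneous k f),
    ← mul_assoc, ← pow_succ, ← hg, map_sub]
  ring

theorem exists_eval_blowUpMap (d : CP1) (v : Fin 2 → ℂ) (hv : v (excIndex d) ≠ 0) :
    ∃ w : Fin 2 → ℂ, ∀ i, eval w (blowUpMap d i) = v i := by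
  unfold blowUpMap
  unfold excIndex at hv
  split_ifs at hv ⊢ with h
  · refine ⟨![v 0, v 1 / v 0 - d.rep 1 / d.rep 0], fun i => ?_⟩
    fin_cases i <;> simp; field_simp
  · refine ⟨![v 0 / v 1, v 1], fun i => ?_⟩
    fin_cases i <;> simp; field_simp

/-- The image of the chart contains every point off the line where the coordinate `excIndex d`
vanishes. A polynomial killed by the pull-back therefore vanishes everywhere after multiplication by
that coordinate. -/
theorem blowUpHom_injective (d : CP1) : Function.Injective (blowUpHom d) := by
  rw [injective_iff_map_eq_zero]
  intro f hf
  refine (mul_eq_zero.1 (?_ : f * exc d = 0)).resolve_right (exc_ne_zero d)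
  refine MvPolynomial.funext fun v => ?_
  rw [map_mul, map_zero, exc, eval_X]
  by_cases hv : v (excIndex d) = 0
  · rw [hv, mul_zero]
  · obtain ⟨w, hw⟩ := exists_eval_blowUpMap d v hv
    have h1 : eval w (blowUpHom d f) = eval v f := by
      rw [blowUpHom, ← aeval_eq_bind₁, ← coe_aeval_eq_eval, ← coe_aeval_eq_eval]
      simp only [RingHom.coe_coe]
      rw [← AlgHom.comp_apply, comp_aeval]
      congr 2
      exact funext hw
    rw [← h1, hf, map_zero, zero_mul]

theorem divExc_exc_pow_mul (d : CP1) (k : ℕ) (f : LocalPoly) :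
    divExc d k (exc d ^ k * f) = f := by
  rw [divExc, exc, X_pow_eq_monomial, divMonomial_monomial_mul]

theorem divExc_add (d : CP1) (k : ℕ) (f g : LocalPoly) :
    divExc d k (f + g) = divExc d k f + divExc d k g := add_divMonomial _ _ _

theorem divExc_C_mul (d : CP1) (k : ℕ) (a : ℂ) (f : LocalPoly) :
    divExc d k (C a * f) = C a * divExc d k f := by
  ext s
  rw [divExc, divExc, coeff_divMonomial, coeff_C_mul, coeff_C_mul, coeff_divMonomial]

/-- The total transform of `f` divided by the `k`-th power of the exceptional divisor. -/
def transform (d : CP1) (k : ℕ) (f : LocalPoly) : LocalPoly := divExc d k (blowUpHom d f)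

theorem transform_add (d : CP1) (k : ℕ) (f g : LocalPoly) :
    transform d k (f + g) = transform d k f + transform d k g := by
  rw [transform, map_add, divExc_add]; rfl

theorem transform_C_mul (d : CP1) (k : ℕ) (a : ℂ) (f : LocalPoly) :
    transform d k (C a * f) = C a * transform d k f := by
  rw [transform, map_mul, blowUpHom, bind₁_C_right, divExc_C_mul]; rfl

theorem exc_pow_mul_transform (d : CP1) {k : ℕ} {f : LocalPoly} (hf : f ∈ ord k) :
    exc d ^ k * transform d k f = blowUpHom d f := by
  obtain ⟨g, hg⟩ := exc_pow_dvd_blowUpHom d hf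
  rw [transform, hg, divExc_exc_pow_mul]

theorem constantCoeff_bind₁ {σ τ : Type} (u : σ → MvPolynomial τ ℂ) (f : MvPolynomial σ ℂ) :
    constantCoeff (bind₁ u f) = eval (fun i => constantCoeff (u i)) f := by
  induction f using MvPolynomial.induction_on with
  | C a => simp
  | add p q hp hq => rw [map_add, map_add, map_add, hp, hq]
  | mul_X p i hp => rw [map_mul, map_mul, map_mul, hp, bind₁_X_right, eval_X]

theorem eval_smul_of_isHomogeneous {σ : Type} {f : MvPolynomial σ ℂ} {k : ℕ}
    (hf : f.IsHomogeneous k) (e : ℂ) (u : σ → ℂ) :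
    eval (fun i => e * u i) f = e ^ k * eval u f := by
  have h := congrArg constantCoeff
    (bind₁_mul_of_isHomogeneous (τ := σ) hf (C e) (fun i => C (u i)))
  rw [constantCoeff_bind₁, map_mul, constantCoeff_bind₁] at h
  simpa using h

theorem eval_rep_eq (d : CP1) {f : LocalPoly} {k : ℕ} (hf : f.IsHomogeneous k) :
    eval d.rep f =
      d.rep (excIndex d) ^ k * eval (fun i => constantCoeff (dirMap d i)) f := by
  rw [← eval_smul_of_isHomogeneous hf]
  congr 2
  exact funext fun i => rep_eq_smul_dirMap d i

theorem constantCoeff_transform (d : CP1) {k : ℕ} {f : LocalPoly} (hf : f ∈ ord k) :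
    constantCoeff (transform d k f) =
      eval (fun i => constantCoeff (dirMap d i)) (homogeneousComponent k f) := by
  obtain ⟨g, hg⟩ := exists_blowUpHom_eq d hf
  rw [transform, hg, divExc_exc_pow_mul, map_add, map_mul, constantCoeff_exc, zero_mul, add_zero,
    constantCoeff_bind₁]

/-- The transform meets `E_Q` exactly in the zeros of the leading form: this turns base points on
`E_Q` into zeros of binary forms. -/
theorem constantCoeff_transform_eq_zero_iff (d : CP1) {k : ℕ} {f : LocalPoly} (hf : f ∈ ord k) :
    constantCoeff (transform d k f) = 0 ↔ eval d.rep (homogeneousComponent k f) = 0 := by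
  rw [constantCoeff_transform d hf,
    eval_rep_eq d (homogeneousComponent_isHomogeneous k f), mul_eq_zero,
    or_iff_right (pow_ne_zero _ (rep_excIndex_ne_zero d))]

theorem transform_ne_zero (d : CP1) {k : ℕ} {f : LocalPoly} (hf : f ∈ ord k) (h : f ≠ 0) :
    transform d k f ≠ 0 := fun h0 => h <| (blowUpHom_injective d) <| by
  rw [← exc_pow_mul_transform d hf, h0, mul_zero, map_zero]

theorem exists_blowUpHom_eq_exc (d : CP1) : ∃ f ∈ ord 1, blowUpHom d f = exc d := by
  refine ⟨X (excIndex d), X_mem_ord _, ?_⟩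
  unfold blowUpHom blowUpMap exc excIndex
  split_ifs <;> simp

/-- Every polynomial in the coordinates of the blow-up is a quotient, by a power of the equation
of the exceptional divisor, of the total transform of a polynomial of sufficient order. -/
theorem exists_exc_pow_mul_eq (d : CP1) (g : LocalPoly) :
    ∃ k, ∀ l ≥ k, ∃ f ∈ ord l, blowUpHom d f = exc d ^ l * g := by
  obtain ⟨e, he, hee⟩ := exists_blowUpHom_eq_exc d
  have hpow : ∀ k, e ^ k ∈ ord k := by
    intro k
    induction k with
    | zero => exact mem_ord_zero _
    | succ k ih => rw [pow_succ]; exact mul_mem_ord ih he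
  suffices h : ∃ k, ∃ f ∈ ord k, blowUpHom d f = exc d ^ k * g by
    obtain ⟨k, f, hf, h⟩ := h
    refine ⟨k, fun l hl => ⟨e ^ (l - k) * f, ?_, ?_⟩⟩
    · have := mul_mem_ord (hpow (l - k)) hf
      rwa [Nat.sub_add_cancel hl] at this
    · rw [map_mul, map_pow, hee, h, ← mul_assoc, ← pow_add, Nat.sub_add_cancel hl]
  -- The chart coordinates are fractions over the exceptional equation: `x = x²/x` and `t = (y - c
  -- x)/x` in one chart, `s = x/y` and `y = y²/y` in the other.
  have hX : ∀ i : Fin 2, ∃ f ∈ ord 1, blowUpHom d f = exc d ^ 1 * X i := by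
    intro i
    unfold blowUpHom blowUpMap exc excIndex
    split_ifs with h <;> fin_cases i
    · exact ⟨X 0 ^ 2, pow_two (X 0 : LocalPoly) ▸
        ord_anti (by omega) (mul_mem_ord (X_mem_ord 0) (X_mem_ord 0)), by simp; ring⟩
    · refine ⟨X 1 - C (d.rep 1 / d.rep 0) * X 0, sub_mem (X_mem_ord 1) ?_, by simp; ring⟩
      rw [C_mul']
      exact Submodule.smul_mem _ _ (X_mem_ord 0)
    · exact ⟨X 0, X_mem_ord 0, by simp; ring⟩
    · exact ⟨X 1 ^ 2, pow_two (X 1 : LocalPoly) ▸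
        ord_anti (by omega) (mul_mem_ord (X_mem_ord 1) (X_mem_ord 1)), by simp; ring⟩
  induction g using MvPolynomial.induction_on with
  | C a => exact ⟨0, C a, mem_ord_zero _, by simp [blowUpHom]⟩
  | add p q hp hq =>
    obtain ⟨k, f, hf, h⟩ := hp
    obtain ⟨l, f', hf', h'⟩ := hq
    refine ⟨k + l, e ^ l * f + e ^ k * f', add_mem ?_ (mul_mem_ord (hpow k) hf'), ?_⟩
    · rw [add_comm k]; exact mul_mem_ord (hpow l) hf
    · rw [map_add, map_mul, map_mul, map_pow, map_pow, hee, h, h']; ring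
  | mul_X p i hp =>
    obtain ⟨k, f, hf, h⟩ := hp
    obtain ⟨f', hf', h'⟩ := hX i
    exact ⟨k + 1, f * f', mul_mem_ord hf hf', by rw [map_mul, h, h']; ring⟩

/-! ### Colengths -/

section Length

variable {K M N P : Type*} [Field K] [AddCommGroup M] [Module K M] [AddCommGroup N] [Module K N]
  [AddCommGroup P] [Module K P]

theorem length_eq_add_quotient (S : Submodule K M) :
    Module.length K M = Module.length K S + Module.length K (M ⧸ S) :=
  Module.length_eq_add_of_exact S.subtype S.mkQ S.subtype_injective S.mkQ_surjective
    (LinearMap.exact_subtype_mkQ S)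

theorem length_quotient_eq_add {S T : Submodule K M} (h : S ≤ T) :
    Module.length K (M ⧸ S) = Module.length K (T.map S.mkQ) + Module.length K (M ⧸ T) := by
  rw [length_eq_add_quotient (T.map S.mkQ), (Submodule.quotientQuotientEquivQuotient S T h).length_eq]

theorem length_eq_ker_add_range (f : M →ₗ[K] N) :
    Module.length K M = Module.length K (LinearMap.ker f) + Module.length K (LinearMap.range f) := by
  rw [length_eq_add_quotient (LinearMap.ker f), f.quotKerEquivRange.length_eq]

theorem length_range_le_of_ker_le (f : M →ₗ[K] N) (g : M →ₗ[K] P)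
    (h : LinearMap.ker g ≤ LinearMap.ker f) :
    Module.length K (LinearMap.range f) ≤ Module.length K (LinearMap.range g) := by
  rw [← f.quotKerEquivRange.length_eq, ← g.quotKerEquivRange.length_eq]
  exact Module.length_le_of_surjective _ (Submodule.factor_surjective h)

theorem length_le_of_forall_finite_subset_le (n : ℕ)
    (h : ∀ s : Finset M, ∃ U : Submodule K M, ↑s ⊆ (U : Set M) ∧ Module.length K U ≤ n) :
    Module.length K M ≤ n := by
  rw [Module.length_eq_rank]
  have : Module.rank K M ≤ n := by
    refine rank_le fun s hs => ?_
    obtain ⟨U, hsU, hU⟩ := h s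
    have h1 : Module.length K (Submodule.span K (s : Set M)) ≤ n :=
      (Module.length_le_of_injective _
        (Submodule.inclusion_injective (Submodule.span_le.2 hsU))).trans hU
    rw [Module.length_eq_finrank, finrank_span_finset_eq_card hs] at h1
    exact_mod_cast h1
  simpa using this

end Length

/-! ### Noether's inequality by dimension counts -/

theorem length_quotient_ord (n : ℕ) :
    Module.length ℂ (LocalPoly ⧸ ord n) = (∑ j ∈ Finset.range n, (j + 1) : ℕ) := by
  let ι := Σ j : Fin n, Fin (j + 1)
  let ex : ι → (Fin 2 →₀ ℕ) := fun p =>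
    Finsupp.single 0 (p.2 : ℕ) + Finsupp.single 1 ((p.1 : ℕ) - p.2)
  have hdeg : ∀ p, (ex p).degree = p.1 := by
    rintro ⟨j, a⟩
    simp only [ex, map_add, Finsupp.degree_single]
    omega
  have hinj : Function.Injective ex := by
    rintro ⟨j, a⟩ ⟨j', a'⟩ h
    have h1 : j = j' := Fin.ext (by rw [← hdeg ⟨j, a⟩, ← hdeg ⟨j', a'⟩, h])
    subst h1
    have h2 := DFunLike.congr_fun h 0
    simp [ex] at h2
    rw [Fin.ext h2]
  let F : LocalPoly →ₗ[ℂ] (ι → ℂ) := LinearMap.pi fun p => lcoeff ℂ (ex p)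
  have hF : ∀ f p, F f p = coeff (ex p) f := fun _ _ => rfl
  have hker : LinearMap.ker F = ord n := by
    ext f
    rw [LinearMap.mem_ker, mem_ord]
    constructor
    · intro h j hj
      ext d
      rw [coeff_homogeneousComponent, coeff_zero]
      split_ifs with hd
      · rw [Finsupp.degree_eq_sum, Fin.sum_univ_two] at hd
        have := congrFun h ⟨⟨j, hj⟩, ⟨d 0, by simp; omega⟩⟩
        rw [hF, Pi.zero_apply] at this
        rw [← this]
        congr 1
        ext i
        fin_cases i <;> simp [ex]
        omega
      · rfl
    · intro h
      funext p
      have := congrArg (coeff (ex p)) (h p.1 p.1.2)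
      rwa [coeff_homogeneousComponent, if_pos (hdeg p), coeff_zero] at this
  have hsurj : Function.Surjective F := by
    intro v
    refine ⟨∑ p, monomial (ex p) (v p), ?_⟩
    funext q
    rw [hF, coeff_sum]
    simp only [coeff_monomial, hinj.eq_iff]
    simp
  rw [← hker, (F.quotKerEquivOfSurjective hsurj).length_eq, Module.length_eq_finrank,
    Module.finrank_fintype_fun_eq_card]
  simp [ι, Fintype.card_sigma, Finset.sum_range]

/-- The linear space underlying the ideal generated by two polynomials. -/
def pencilIdeal (f g : LocalPoly) : Submodule ℂ LocalPoly :=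
  (Ideal.span {f, g}).restrictScalars ℂ

theorem mem_pencilIdeal {f g h : LocalPoly} :
    h ∈ pencilIdeal f g ↔ ∃ a b, a * f + b * g = h := by
  rw [pencilIdeal, Submodule.restrictScalars_mem, Ideal.mem_span_pair]

/-- The dimension of the quotient by the ideal generated by two polynomials. -/
def colength (f g : LocalPoly) : ℕ∞ := Module.length ℂ (LocalPoly ⧸ pencilIdeal f g)

/-- The combinations of two polynomials with coefficients of order at least `j`. -/
def ordPencil (j : ℕ) (f g : LocalPoly) : Submodule ℂ LocalPoly where
  carrier := {h | ∃ a ∈ ord j, ∃ b ∈ ord j, a * f + b * g = h}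
  add_mem' := by
    rintro _ _ ⟨a, ha, b, hb, rfl⟩ ⟨a', ha', b', hb', rfl⟩
    exact ⟨a + a', add_mem ha ha', b + b', add_mem hb hb', by ring⟩
  zero_mem' := ⟨0, zero_mem _, 0, zero_mem _, by ring⟩
  smul_mem' := by
    rintro c _ ⟨a, ha, b, hb, rfl⟩
    exact ⟨c • a, Submodule.smul_mem _ _ ha, c • b, Submodule.smul_mem _ _ hb, by
      rw [smul_add, smul_mul_assoc, smul_mul_assoc]⟩

/-- The image is that of `(a, b) ↦ a f + b g` on pairs modulo order `i + m`. The Koszul relations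
`(c g, -c f)` lie in the kernel, and they are parametrized faithfully by `c` modulo order `i`. -/
theorem length_map_pencilIdeal_le {f g : LocalPoly} {m : ℕ} (hf : f ∈ ord m) (hg : g ∈ ord m)
    (h : homogeneousComponent m f ≠ 0 ∨ homogeneousComponent m g ≠ 0) (i : ℕ) :
    Module.length ℂ (LocalPoly ⧸ ord i) +
      Module.length ℂ ((pencilIdeal f g).map (ordPencil (i + m) f g).mkQ) ≤
      Module.length ℂ (LocalPoly ⧸ ord (i + m)) + Module.length ℂ (LocalPoly ⧸ ord (i + m)) := by
  set Q := LocalPoly ⧸ ord (i + m)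
  let mulL : LocalPoly → LocalPoly →ₗ[ℂ] LocalPoly := fun f => LinearMap.mulRight ℂ f
  let ρ : Q × Q →ₗ[ℂ] LocalPoly ⧸ ordPencil (i + m) f g := LinearMap.coprod
    (Submodule.mapQ _ _ (mulL f) fun a ha => ⟨a, ha, 0, zero_mem _, by simp [mulL]⟩)
    (Submodule.mapQ _ _ (mulL g) fun a ha => ⟨0, zero_mem _, a, ha, by simp [mulL]⟩)
  let σ : LocalPoly →ₗ[ℂ] Q × Q := LinearMap.prod
    ((ord (i + m)).mkQ ∘ₗ mulL g) (-((ord (i + m)).mkQ ∘ₗ mulL f))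
  have hρ : ∀ a b, ρ (Submodule.Quotient.mk a, Submodule.Quotient.mk b) =
      Submodule.Quotient.mk (a * f + b * g) := fun _ _ => rfl
  -- One of `f`, `g` has order exactly `m`, so multiplication by it raises orders by exactly `m`.
  have hσ : LinearMap.ker σ = ord i := by
    ext c
    have : σ c = 0 ↔ c * g ∈ ord (i + m) ∧ c * f ∈ ord (i + m) := by
      rw [← Submodule.Quotient.mk_eq_zero (ord (i + m)), ← Submodule.Quotient.mk_eq_zero (ord (i + m))]
      change (Submodule.Quotient.mk (c * g), -Submodule.Quotient.mk (c * f)) = (0 : Q × Q) ↔ _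
      rw [Prod.mk_eq_zero, neg_eq_zero]
    rw [LinearMap.mem_ker, this]
    constructor
    · rintro ⟨h1, h2⟩
      rw [mul_comm, add_comm] at h1 h2
      rcases h with h | h
      · exact mem_ord_of_mul_mem_ord hf h h2
      · exact mem_ord_of_mul_mem_ord hg h h1
    · exact fun hc => ⟨mul_mem_ord hc hg, mul_mem_ord hc hf⟩
  have hσρ : LinearMap.range σ ≤ LinearMap.ker ρ := by
    rintro _ ⟨c, rfl⟩
    rw [LinearMap.mem_ker]
    change ρ (Submodule.Quotient.mk (c * g), Submodule.Quotient.mk (-(c * f))) = 0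
    rw [hρ, show c * g * f + -(c * f) * g = 0 by ring]; rfl
  have hrange : LinearMap.range ρ = (pencilIdeal f g).map (ordPencil (i + m) f g).mkQ := by
    ext x
    rw [LinearMap.mem_range, Submodule.mem_map]
    constructor
    · rintro ⟨⟨a, b⟩, rfl⟩
      induction a using Submodule.Quotient.induction_on with | _ a
      induction b using Submodule.Quotient.induction_on with | _ b
      exact ⟨a * f + b * g, mem_pencilIdeal.2 ⟨a, b, rfl⟩, rfl⟩
    · rintro ⟨_, h, rfl⟩
      obtain ⟨a, b, rfl⟩ := mem_pencilIdeal.1 h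
      exact ⟨(Submodule.Quotient.mk a, Submodule.Quotient.mk b), rfl⟩
  rw [← hrange, ← hσ, σ.quotKerEquivRange.length_eq, ← Module.length_prod ℂ Q Q,
    length_eq_ker_add_range ρ]
  exact add_le_add_left (Module.length_le_of_injective _ (Submodule.inclusion_injective hσρ)) _

theorem transform_mem_pencilIdeal (d : CP1) {f g p : LocalPoly} {i m : ℕ} (hf : f ∈ ord m)
    (hg : g ∈ ord m) (h : p ∈ ordPencil (i + m) f g) :
    transform d (i + 2 * m) p ∈ pencilIdeal (transform d m f) (transform d m g) := by
  obtain ⟨a, ha, b, hb, rfl⟩ := h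
  refine mem_pencilIdeal.2 ⟨transform d (i + m) a, transform d (i + m) b, ?_⟩
  refine mul_left_cancel₀ (pow_ne_zero (i + 2 * m) (exc_ne_zero d)) ?_
  have h1 : a * f + b * g ∈ ord (i + 2 * m) := by
    rw [two_mul, ← add_assoc]
    exact add_mem (mul_mem_ord ha hf) (mul_mem_ord hb hg)
  rw [exc_pow_mul_transform d h1, map_add, map_mul, map_mul, ← exc_pow_mul_transform d ha,
    ← exc_pow_mul_transform d hb, ← exc_pow_mul_transform d hf, ← exc_pow_mul_transform d hg]
  ring

/-- The transform as a linear map. -/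
def transformL (d : CP1) (k : ℕ) : LocalPoly →ₗ[ℂ] LocalPoly where
  toFun := transform d k
  map_add' := transform_add d k
  map_smul' := fun a f => by rw [← C_mul', transform_C_mul, C_mul']; rfl

/-- With `T n = n (n + 1) / 2`, the second difference `T (i + 2 m) - 2 T (i + m) + T i` is `m ^ 2`;
this is the source of the square in Noether's inequality. -/
theorem sum_range_succ_second_difference {A B : ℕ∞} {i m D : ℕ}
    (h3 : A + D = B + (∑ j ∈ Finset.range (i + 2 * m), (j + 1) : ℕ))
    (h4 : (∑ j ∈ Finset.range i, (j + 1) : ℕ) + A ≤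
      (∑ j ∈ Finset.range (i + m), (j + 1) : ℕ) + (∑ j ∈ Finset.range (i + m), (j + 1) : ℕ)) :
    B + (m ^ 2 : ℕ) ≤ D := by
  have hT : ∀ n, 2 * (∑ j ∈ Finset.range n, (j + 1)) = n * (n + 1) := by
    intro n
    induction n with
    | zero => rfl
    | succ n ih => rw [Finset.sum_range_succ, mul_add, ih]; ring
  have t1 := hT i
  have t2 := hT (i + m)
  have t3 := hT (i + 2 * m)
  generalize (∑ j ∈ Finset.range i, (j + 1)) = T1 at *
  generalize (∑ j ∈ Finset.range (i + m), (j + 1)) = T2 at *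
  generalize (∑ j ∈ Finset.range (i + 2 * m), (j + 1)) = T3 at *
  have hA : A ≠ ⊤ := by
    rintro rfl
    rw [add_top, top_le_iff] at h4
    exact absurd h4 (by exact_mod_cast ENat.natCast_ne_top _)
  lift A to ℕ using hA
  have hB : B ≠ ⊤ := by
    rintro rfl
    rw [top_add] at h3
    exact absurd h3 (by exact_mod_cast ENat.natCast_ne_top _)
  lift B to ℕ using hB
  norm_cast at h3 h4 ⊢
  nlinarith

/-- The map from the polynomials of order at least `k` to the coordinate ring of the transform of
a pencil. -/
def ordToQuotient (d : CP1) (k m : ℕ) (f g : LocalPoly) :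
    ord k →ₗ[ℂ] LocalPoly ⧸ pencilIdeal (transform d m f) (transform d m g) :=
  (pencilIdeal (transform d m f) (transform d m g)).mkQ ∘ₗ (transformL d k).domRestrict (ord k)

/-- Let `K` be `ordPencil (i + m) f g`. It lies in the ideal and in `ord (i + 2 * m)`, so the
codimension of `K` can be computed through either. Comparing the two bounds `ord (i + 2 * m)` modulo
`K` by `D - m ^ 2`, and the map to the transformed quotient kills `K`. -/
theorem length_range_ordToQuotient_add_le (d : CP1) {f g : LocalPoly} {m D : ℕ} (hf : f ∈ ord m)
    (hg : g ∈ ord m) (h : homogeneousComponent m f ≠ 0 ∨ homogeneousComponent m g ≠ 0)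
    (hD : (D : ℕ∞) = colength f g) (i : ℕ) :
    Module.length ℂ (LinearMap.range (ordToQuotient d (i + 2 * m) m f g)) + (m ^ 2 : ℕ) ≤ D := by
  have hK1 : ordPencil (i + m) f g ≤ pencilIdeal f g := by
    rintro _ ⟨a, -, b, -, rfl⟩
    exact mem_pencilIdeal.2 ⟨a, b, rfl⟩
  have hK2 : ordPencil (i + m) f g ≤ ord (i + 2 * m) := by
    rintro _ ⟨a, ha, b, hb, rfl⟩
    rw [two_mul, ← add_assoc]
    exact add_mem (mul_mem_ord ha hf) (mul_mem_ord hb hg)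
  have h1 : Module.length ℂ (LinearMap.range (ordToQuotient d (i + 2 * m) m f g)) ≤
      Module.length ℂ ((ord (i + 2 * m)).map (ordPencil (i + m) f g).mkQ) := by
    rw [← LinearMap.range_domRestrict]
    refine length_range_le_of_ker_le _ _ fun x hx => ?_
    rw [LinearMap.mem_ker] at hx ⊢
    exact (Submodule.Quotient.mk_eq_zero _).2 (transform_mem_pencilIdeal d hf hg
      ((Submodule.Quotient.mk_eq_zero (ordPencil (i + m) f g)).1 hx))
  have h2 := length_quotient_eq_add hK1
  have h3 := length_quotient_eq_add hK2
  have h4 := length_map_pencilIdeal_le hf hg h i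
  rw [h2] at h3
  change _ + colength f g = _ at h3
  rw [← hD, length_quotient_ord] at h3
  rw [length_quotient_ord, length_quotient_ord] at h4
  exact (add_le_add_left h1 _).trans (sum_range_succ_second_difference h3 h4)

/-- Noether's inequality: blowing up a point of multiplicity `m` decreases the colength by at
least `m ^ 2`. -/
theorem colength_transform_add_le (d : CP1) {f g : LocalPoly} {m : ℕ} (hf : f ∈ ord m)
    (hg : g ∈ ord m) (h : homogeneousComponent m f ≠ 0 ∨ homogeneousComponent m g ≠ 0) :
    colength (transform d m f) (transform d m g) + (m ^ 2 : ℕ) ≤ colength f g := by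
  by_cases htop : colength f g = ⊤
  · rw [htop]; exact le_top
  obtain ⟨D, hD⟩ := ENat.ne_top_iff_exists.1 htop
  have key := length_range_ordToQuotient_add_le d hf hg h hD
  have hm : m ^ 2 ≤ D := by
    have := le_add_self.trans (key 0)
    exact_mod_cast this
  have hle : colength (transform d m f) (transform d m g) ≤ (D - m ^ 2 : ℕ) := by
    refine length_le_of_forall_finite_subset_le _ fun s => ?_
    -- A given finite set of classes is reached by transforms of polynomials of high order. Since
    -- the bound `D - m ^ 2` does not depend on that order, it passes to the whole quotient.
    have hex : ∃ k, ∀ l ≥ k, ∀ x ∈ s, x ∈ LinearMap.range (ordToQuotient d l m f g) := by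
      classical
      induction s using Finset.induction_on with
      | empty => exact ⟨0, fun l _ => by simp⟩
      | insert x s _ ih =>
        obtain ⟨k, hk⟩ := ih
        induction x using Submodule.Quotient.induction_on with | _ x
        obtain ⟨k', hk'⟩ := exists_exc_pow_mul_eq d x
        refine ⟨max k k', fun l hl => ?_⟩
        rw [Finset.forall_mem_insert]
        refine ⟨?_, hk l (le_of_max_le_left hl)⟩
        obtain ⟨p, hp, hpx⟩ := hk' l (le_of_max_le_right hl)
        refine ⟨⟨p, hp⟩, ?_⟩
        change Submodule.Quotient.mk (transform d l p) = Submodule.Quotient.mk x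
        have hx : transform d l p = x := by rw [transform, hpx, divExc_exc_pow_mul]
        rw [hx]
    obtain ⟨k, hk⟩ := hex
    refine ⟨_, hk (k + 2 * m) (by omega), ?_⟩
    have := key k
    rw [ENat.natCast_sub]
    exact ENat.le_sub_of_add_le_right (ENat.natCast_ne_top _) this
  rw [← hD]
  refine (add_le_add_left hle _).trans ?_
  norm_cast
  omega

/-! ### Wronskians -/

/-- Linear independence of two polynomials over the complex numbers. -/
def Indep {σ : Type} (f g : MvPolynomial σ ℂ) : Prop :=
  ∀ a b : ℂ, C a * f + C b * g = 0 → a = 0 ∧ b = 0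

/-- The form `g df - f dg`. -/
def wronskian (f g : LocalPoly) : LocalForm := fun i => g * pderiv i f - f * pderiv i g

/-- The contraction of a form with the Euler vector field. -/
def contract (ω : LocalForm) : LocalPoly := X 0 * ω 0 + X 1 * ω 1

theorem contract_wronskian (f g : LocalPoly) :
    contract (wronskian f g) = g * euler f - f * euler g := by
  simp only [contract, wronskian, euler]; ring

theorem mem_ord_formMult (ω : LocalForm) (i : Fin 2) : ω i ∈ ord (formMult ω) := fun j hj => by
  by_contra h
  exact Nat.notMem_of_lt_sInf hj ⟨i, h⟩

theorem exists_homogeneousComponent_formMult_ne_zero {ω : LocalForm} (hω : ω ≠ 0) :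
    ∃ i, homogeneousComponent (formMult ω) (ω i) ≠ 0 := by
  obtain ⟨i, hi⟩ := Function.ne_iff.1 hω
  obtain ⟨k, hk⟩ := exists_homogeneousComponent_ne_zero hi
  exact Nat.sInf_mem (s := {k | ∃ i, homogeneousComponent k (ω i) ≠ 0}) ⟨k, i, hk⟩

theorem formMult_eq {ω : LocalForm} {k : ℕ} (h : ∀ i, ω i ∈ ord k)
    (h' : ∃ i, homogeneousComponent k (ω i) ≠ 0) : formMult ω = k := by
  refine le_antisymm (Nat.sInf_le h') (le_of_not_gt fun hlt => ?_)
  obtain ⟨j, hj⟩ := h'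
  have hω : ω ≠ 0 := by rintro rfl; exact hj (map_zero _)
  obtain ⟨i, hi⟩ := exists_homogeneousComponent_formMult_ne_zero hω
  exact hi (h i _ hlt)

theorem contract_mem_ord (ω : LocalForm) : contract ω ∈ ord (formMult ω + 1) := by
  rw [add_comm]
  exact add_mem (mul_mem_ord (X_mem_ord 0) (mem_ord_formMult ω 0))
    (mul_mem_ord (X_mem_ord 1) (mem_ord_formMult ω 1))

theorem homogeneousComponent_contract (ω : LocalForm) :
    homogeneousComponent (formMult ω + 1) (contract ω) = charPoly ω := by
  rw [contract, map_add, homogeneousComponent_X_mul, homogeneousComponent_X_mul, charPoly]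

theorem contract_mul (h : LocalPoly) {W ω : LocalForm} (hW : ∀ i, W i = h * ω i) :
    contract W = h * contract ω := by
  rw [contract, contract, hW, hW]; ring

theorem wronskian_mem_ord {f g : LocalPoly} {a b : ℕ} (hf : f ∈ ord a) (hg : g ∈ ord b)
    (i : Fin 2) : wronskian f g i ∈ ord (a + b - 1) :=
  sub_mem (ord_anti (by omega) (mul_mem_ord hg (pderiv_mem_ord hf)))
    (ord_anti (by omega) (mul_mem_ord hf (pderiv_mem_ord hg)))

theorem homogeneousComponent_contract_wronskian {f g : LocalPoly} {a b : ℕ} (hf : f ∈ ord a)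
    (hg : g ∈ ord b) : homogeneousComponent (a + b) (contract (wronskian f g)) =
      C ((a : ℂ) - b) * (homogeneousComponent a f * homogeneousComponent b g) := by
  rw [contract_wronskian, map_sub, add_comm a, homogeneousComponent_mul_of_mem_ord hg
    (euler_mem_ord hf), add_comm b, homogeneousComponent_mul_of_mem_ord hf (euler_mem_ord hg),
    homogeneousComponent_euler, homogeneousComponent_euler, nsmul_eq_mul, nsmul_eq_mul, map_sub,
    map_natCast, map_natCast]
  ring

theorem mult_C_mul {c : ℂ} (hc : c ≠ 0) (f : LocalPoly) : mult (C c * f) = mult f := by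
  unfold mult
  congr 1
  ext k
  simp [hc]

/-- The wronskian of two polynomials of different multiplicities. -/
theorem charPoly_ne_zero_of_lt {f g h : LocalPoly} {ω : LocalForm} {a b : ℕ} (hab : a < b)
    (hf : f ∈ ord a) (hg : g ∈ ord b) (hf' : homogeneousComponent a f ≠ 0)
    (hg' : homogeneousComponent b g ≠ 0) (hW : ∀ i, wronskian f g i = h * ω i) :
    h ≠ 0 ∧ ω ≠ 0 ∧ charPoly ω ≠ 0 ∧ a + b = mult h + formMult ω + 1 := by
  have h1 : homogeneousComponent (a + b) (h * contract ω) ≠ 0 := by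
    rw [← contract_mul h hW, homogeneousComponent_contract_wronskian hf hg]
    refine mul_ne_zero (fun h0 => ?_) (mul_ne_zero hf' hg')
    rw [C_eq_zero, sub_eq_zero, Nat.cast_inj] at h0
    exact hab.ne h0
  have hh : h ≠ 0 := by rintro rfl; simp at h1
  have hω : ω ≠ 0 := by rintro rfl; simp [contract] at h1
  obtain ⟨i, hi⟩ := exists_homogeneousComponent_formMult_ne_zero hω
  have h2 : homogeneousComponent (mult h + formMult ω) (wronskian f g i) ≠ 0 := by
    rw [hW, homogeneousComponent_mul_of_mem_ord (mem_ord_mult h) (mem_ord_formMult ω i)]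
    exact mul_ne_zero (homogeneousComponent_mult_ne_zero hh) hi
  -- The order of the form bounds `mult h + formMult ω` from below, and the non-zero component of
  -- the contraction in degree `a + b` bounds it from above. The bounds coincide, so that component
  -- is the leading form of `h` times `charPoly ω`.
  have h3 : a + b - 1 ≤ mult h + formMult ω := by
    by_contra hlt
    exact h2 (wronskian_mem_ord hf hg i _ (not_le.1 hlt))
  have h4 : mult h + (formMult ω + 1) ≤ a + b := by
    by_contra hlt
    exact h1 (mul_mem_ord (mem_ord_mult h) (contract_mem_ord ω) _ (not_le.1 hlt))
  refine ⟨hh, hω, fun h0 => h1 ?_, by omega⟩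
  rw [show a + b = mult h + (formMult ω + 1) by omega,
    homogeneousComponent_mul_of_mem_ord (mem_ord_mult h) (contract_mem_ord ω),
    homogeneousComponent_contract, h0, mul_zero]

theorem totalDegree_le_of_dvd {σ : Type} {f g : MvPolynomial σ ℂ} (h : f ∣ g) (hg : g ≠ 0) :
    f.totalDegree ≤ g.totalDegree := by
  obtain ⟨u, rfl⟩ := h
  rw [totalDegree_mul_of_isDomain (left_ne_zero_of_mul hg) (right_ne_zero_of_mul hg)]
  exact Nat.le_add_right _ _

theorem totalDegree_pderiv_lt {σ : Type} {f : MvPolynomial σ ℂ} {i : σ} (h : pderiv i f ≠ 0) :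
    (pderiv i f).totalDegree < f.totalDegree := by
  obtain ⟨d, hd, hdeg⟩ := Finset.exists_mem_eq_sup _ (support_nonempty.2 h)
    (fun s : σ →₀ ℕ => s.sum fun _ e => e)
  rw [← totalDegree] at hdeg
  rw [mem_support_iff, coeff_pderiv] at hd
  have := le_totalDegree (mem_support_iff.2 (left_ne_zero_of_mul hd))
  rw [hdeg]
  refine lt_of_lt_of_le ?_ this
  rw [Finsupp.sum_add_index' (by simp) (by simp)]
  simp

theorem eq_C_of_pderiv_eq_zero {σ : Type} {f : MvPolynomial σ ℂ} (h : ∀ i, pderiv i f = 0) :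
    f = C (coeff 0 f) := by
  classical
  ext d
  rw [coeff_C]
  split_ifs with hd
  · rw [hd]
  · obtain ⟨i, hi⟩ := Finsupp.ne_iff.1 (Ne.symm hd)
    have hle : Finsupp.single i 1 ≤ d := by
      rw [Finsupp.single_le_iff]
      exact Nat.one_le_iff_ne_zero.2 hi
    have := congrArg (coeff (d - Finsupp.single i 1)) (h i)
    rw [coeff_pderiv, tsub_add_cancel_of_le hle, coeff_zero, mul_eq_zero] at this
    exact this.resolve_right (Nat.cast_add_one_ne_zero _)

/-- Coprimality makes `u` divide its own partial derivatives, which have smaller degree and must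
vanish. -/
theorem eq_C_of_wronskian_eq_zero {σ : Type} {u v : MvPolynomial σ ℂ} (huv : IsRelPrime u v)
    (h : ∀ i, v * pderiv i u = u * pderiv i v) : u = C (coeff 0 u) := by
  refine eq_C_of_pderiv_eq_zero fun i => ?_
  by_contra hne
  have h1 : u ∣ pderiv i u := huv.dvd_of_dvd_mul_left ⟨_, h i⟩
  exact absurd (totalDegree_le_of_dvd h1 hne) (not_le.2 (totalDegree_pderiv_lt hne))

/-- The vanishing of the form says that `f / g` has zero differential, hence is constant; the proof
carries this out on the reduced fraction. -/
theorem not_indep_of_wronskian_eq_zero {σ : Type} {f g : MvPolynomial σ ℂ}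
    (h : ∀ i, g * pderiv i f = f * pderiv i g) : ¬ Indep f g := by
  intro hfg
  have hf : f ≠ 0 := by
    rintro rfl
    exact one_ne_zero (hfg 1 0 (by simp)).1
  obtain ⟨u, v, D, huv, hu, hv⟩ := UniqueFactorizationMonoid.exists_reduced_factors f hf g
  have hD : D ≠ 0 := by rintro rfl; exact hf (by rw [← hu, zero_mul])
  have h' : ∀ i, v * pderiv i u = u * pderiv i v := by
    intro i
    have := h i
    rw [← hu, ← hv, pderiv_mul, pderiv_mul] at this
    refine mul_left_cancel₀ (mul_ne_zero hD hD) ?_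
    linear_combination this
  have hu' := eq_C_of_wronskian_eq_zero huv h'
  have hv' := eq_C_of_wronskian_eq_zero huv.symm fun i => (h' i).symm
  have := hfg (coeff 0 v) (-coeff 0 u) (by rw [← hu, ← hv, C_neg, ← hu', ← hv']; ring)
  rw [neg_eq_zero] at this
  rw [hu', hv', this.1, this.2, C_0] at huv
  exact not_isUnit_zero (huv (dvd_refl _) (dvd_refl _))

theorem charPoly_eq_zero_of_indep {f g h : LocalPoly} {ω : LocalForm} {m : ℕ}
    (hf : f ∈ ord m) (hg : g ∈ ord m)
    (hfg : Indep (homogeneousComponent m f) (homogeneousComponent m g))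
    (hW : ∀ i, wronskian f g i = h * ω i) :
    h ≠ 0 ∧ ω ≠ 0 ∧ charPoly ω = 0 ∧ 2 * m = mult h + formMult ω + 1 := by
  -- Components of degree `0` are constants, and two constants are always dependent.
  have hm : m ≠ 0 := by
    rintro rfl
    have := hfg (coeff 0 g) (-coeff 0 f) (by
      rw [homogeneousComponent_zero, homogeneousComponent_zero, C_neg]; ring)
    refine one_ne_zero (hfg 1 0 ?_).1
    rw [homogeneousComponent_zero, neg_eq_zero.1 this.2]
    simp
  have h1 : ∃ i, homogeneousComponent (2 * m - 1) (wronskian f g i) ≠ 0 := by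
    by_contra! h0
    refine not_indep_of_wronskian_eq_zero (fun i => ?_) hfg
    have := h0 i
    rw [wronskian, map_sub, show 2 * m - 1 = m + (m - 1) by omega,
      homogeneousComponent_mul_of_mem_ord hg (pderiv_mem_ord hf),
      homogeneousComponent_mul_of_mem_ord hf (pderiv_mem_ord hg),
      homogeneousComponent_pderiv, homogeneousComponent_pderiv,
      Nat.sub_add_cancel (Nat.one_le_iff_ne_zero.2 hm), sub_eq_zero] at this
    exact this
  obtain ⟨j, hj⟩ := h1
  have hh : h ≠ 0 := by rintro rfl; rw [hW] at hj; simp at hj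
  have hω : ω ≠ 0 := by rintro rfl; rw [hW] at hj; simp at hj
  obtain ⟨i, hi⟩ := exists_homogeneousComponent_formMult_ne_zero hω
  have h2 : homogeneousComponent (mult h + formMult ω) (wronskian f g i) ≠ 0 := by
    rw [hW, homogeneousComponent_mul_of_mem_ord (mem_ord_mult h) (mem_ord_formMult ω i)]
    exact mul_ne_zero (homogeneousComponent_mult_ne_zero hh) hi
  have h3 : m + m - 1 ≤ mult h + formMult ω := by
    by_contra hlt
    exact h2 (wronskian_mem_ord hf hg i _ (not_le.1 hlt))
  have h4 : mult h + formMult ω ≤ 2 * m - 1 := by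
    by_contra hlt
    refine hj ?_
    rw [hW]
    exact mul_mem_ord (mem_ord_mult h) (mem_ord_formMult ω j) _ (not_le.1 hlt)
  refine ⟨hh, hω, ?_, by omega⟩
  have h5 : homogeneousComponent (m + m) (h * contract ω) = 0 := by
    rw [← contract_mul h hW, homogeneousComponent_contract_wronskian hf hg, sub_self, C_0, zero_mul]
  rw [show m + m = mult h + (formMult ω + 1) by omega,
    homogeneousComponent_mul_of_mem_ord (mem_ord_mult h) (contract_mem_ord ω),
    homogeneousComponent_contract] at h5
  exact (mul_eq_zero.1 h5).resolve_left (homogeneousComponent_mult_ne_zero hh)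

theorem wronskian_comm (f g : LocalPoly) (i : Fin 2) :
    wronskian f g i = -wronskian g f i := by
  simp only [wronskian]; ring

theorem Indep.symm {σ : Type} {f g : MvPolynomial σ ℂ} (h : Indep f g) : Indep g f :=
  fun a b hab => (h b a (by rw [add_comm, hab])).symm

/-- If the leading forms of `f` and `g` are proportional, the form obtained from their wronskian by
dividing out a factor is not dicritical. -/
theorem charPoly_ne_zero_of_left {f g h : LocalPoly} {ω : LocalForm} {m : ℕ}
    (hf : f ∈ ord m) (hg : g ∈ ord m)
    (hm : homogeneousComponent m f ≠ 0 ∨ homogeneousComponent m g ≠ 0) (hfg : Indep f g)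
    (hW : ∀ i, wronskian f g i = h * ω i) {a b : ℂ} (ha : a ≠ 0)
    (hab : C a * homogeneousComponent m f + C b * homogeneousComponent m g = 0) :
    h ≠ 0 ∧ ω ≠ 0 ∧ charPoly ω ≠ 0 ∧ 2 * m ≤ mult h + formMult ω := by
  set p := C a * f + C b * g with hp
  have hp0 : p ≠ 0 := fun h0 => ha (hfg a b h0).1
  have hpm : p ∈ ord (m + 1) := by
    refine mem_ord_succ ?_ (by rw [hp, map_add, homogeneousComponent_C_mul,
      homogeneousComponent_C_mul, hab])
    rw [hp, C_mul', C_mul']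
    exact add_mem (Submodule.smul_mem _ _ hf) (Submodule.smul_mem _ _ hg)
  have hlt : m < mult p := by
    by_contra hle
    exact homogeneousComponent_mult_ne_zero hp0 (hpm _ (by omega))
  have hg' : homogeneousComponent m g ≠ 0 := by
    intro h0
    rw [h0, mul_zero, add_zero, mul_eq_zero, C_eq_zero] at hab
    exact (hm.resolve_right (not_not.2 h0)) (hab.resolve_left ha)
  -- `g` and `p` span the same pencil as `f` and `g`, so the form changes only by the determinant of
  -- the change of basis; the orders of `g` and `p` now differ.
  have hW' : ∀ i, wronskian g p i = C (-a) * h * ω i := by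
    intro i
    rw [mul_assoc, ← hW i, C_neg, wronskian, wronskian, hp]
    simp only [map_add, pderiv_C_mul]
    ring
  obtain ⟨h1, h2, h3, h4⟩ := charPoly_ne_zero_of_lt hlt hg (mem_ord_mult p) hg'
    (homogeneousComponent_mult_ne_zero hp0) hW'
  rw [mult_C_mul (neg_ne_zero.2 ha)] at h4
  exact ⟨right_ne_zero_of_mul h1, h2, h3, by omega⟩

theorem charPoly_ne_zero_of_not_indep {f g h : LocalPoly} {ω : LocalForm} {m : ℕ}
    (hf : f ∈ ord m) (hg : g ∈ ord m)
    (hm : homogeneousComponent m f ≠ 0 ∨ homogeneousComponent m g ≠ 0) (hfg : Indep f g)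
    (hW : ∀ i, wronskian f g i = h * ω i)
    (hi : ¬ Indep (homogeneousComponent m f) (homogeneousComponent m g)) :
    h ≠ 0 ∧ ω ≠ 0 ∧ charPoly ω ≠ 0 ∧ 2 * m ≤ mult h + formMult ω := by
  unfold Indep at hi
  push Not at hi
  obtain ⟨a, b, hab, hne⟩ := hi
  by_cases ha : a = 0
  · have hW' : ∀ i, wronskian g f i = C (-1) * h * ω i := fun i => by
      rw [wronskian_comm, hW, C_neg, C_1]; ring
    have := charPoly_ne_zero_of_left hg hf hm.symm hfg.symm hW' (hne ha)
      (by rw [add_comm]; exact hab)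
    rw [mult_C_mul (by norm_num)] at this
    exact ⟨right_ne_zero_of_mul this.1, this.2⟩
  · exact charPoly_ne_zero_of_left hf hg hm hfg hW ha hab

theorem charPoly_eq_zero_iff {f g h : LocalPoly} {ω : LocalForm} {m : ℕ}
    (hf : f ∈ ord m) (hg : g ∈ ord m)
    (hm : homogeneousComponent m f ≠ 0 ∨ homogeneousComponent m g ≠ 0) (hfg : Indep f g)
    (hW : ∀ i, wronskian f g i = h * ω i) :
    charPoly ω = 0 ↔ Indep (homogeneousComponent m f) (homogeneousComponent m g) :=
  ⟨fun h0 => by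
    by_contra hi
    exact (charPoly_ne_zero_of_not_indep hf hg hm hfg hW hi).2.2.1 h0,
  fun hi => (charPoly_eq_zero_of_indep hf hg hi hW).2.2.1⟩

-- The left side is the power of the exceptional equation coming out of the pulled-back `g df - f
-- dg` when `f` and `g` are divided by its `m`-th power; the right side is the power coming out of
-- `h` and `ω`. The inequality keeps the new cofactor a polynomial.
open scoped Classical in
theorem two_mul_le_mult_add {f g h : LocalPoly} {ω : LocalForm} {m : ℕ}
    (hf : f ∈ ord m) (hg : g ∈ ord m)
    (hm : homogeneousComponent m f ≠ 0 ∨ homogeneousComponent m g ≠ 0) (hfg : Indep f g)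
    (hW : ∀ i, wronskian f g i = h * ω i) :
    2 * m ≤ mult h + if charPoly ω = 0 then formMult ω + 1 else formMult ω := by
  by_cases hi : Indep (homogeneousComponent m f) (homogeneousComponent m g)
  · obtain ⟨-, -, h1, h2⟩ := charPoly_eq_zero_of_indep hf hg hi hW
    rw [if_pos h1]; omega
  · obtain ⟨-, -, h1, h2⟩ := charPoly_ne_zero_of_not_indep hf hg hm hfg hW hi
    rwa [if_neg h1]

/-! ### Binary forms -/

theorem dvd_of_C_mul_add_C_mul_eq_zero {σ : Type} {f g : MvPolynomial σ ℂ} {a b : ℂ} (ha : a ≠ 0)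
    (hab : C a * f + C b * g = 0) : g ∣ f := by
  refine ⟨C (-(b / a)), mul_left_cancel₀ (C_ne_zero.2 ha) ?_⟩
  rw [mul_left_comm, ← C_mul, show a * -(b / a) = -b by field_simp, C_neg]
  linear_combination hab

/-- A gcd of full degree `m` has both forms as scalar multiples, and proportional forms have one of
themselves as common divisor of degree `m`. -/
theorem totalDegree_pgcd_lt_iff {σ : Type} {f g : MvPolynomial σ ℂ} {m : ℕ}
    (hf : f.IsHomogeneous m) (hg : g.IsHomogeneous m) (h : f ≠ 0 ∨ g ≠ 0) :
    (pgcd f g).totalDegree < m ↔ Indep f g := by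
  constructor
  · intro hlt a b hab
    have h0 : pgcd f g ≠ 0 := by
      rcases h with h | h
      · exact fun h0 => h (zero_dvd_iff.1 (h0 ▸ pgcd_dvd_left f g))
      · exact fun h0 => h (zero_dvd_iff.1 (h0 ▸ pgcd_dvd_right f g))
    have key : ∀ {p : MvPolynomial σ ℂ}, p.IsHomogeneous m → p ∣ f → ¬ p ∣ g := by
      intro p hp h1 h2
      have h3 := totalDegree_le_of_dvd (dvd_pgcd h1 h2) h0
      rw [hp.totalDegree (ne_zero_of_dvd_ne_zero h0 (dvd_pgcd h1 h2))] at h3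
      omega
    refine ⟨?_, ?_⟩ <;> by_contra hne
    · exact key hg (dvd_of_C_mul_add_C_mul_eq_zero hne hab) dvd_rfl
    · exact key hf dvd_rfl (dvd_of_C_mul_add_C_mul_eq_zero hne (by rw [add_comm]; exact hab))
  · intro hi
    by_contra hle
    have key : ∀ {p : MvPolynomial σ ℂ}, p.IsHomogeneous m → pgcd f g ∣ p →
        ∃ c, p = C c * pgcd f g := by
      rintro p hp ⟨u, rfl⟩
      by_cases h0 : pgcd f g * u = 0
      · exact ⟨0, by rw [h0, C_0, zero_mul]⟩
      · have h1 := hp.totalDegree h0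
        rw [totalDegree_mul_of_isDomain (left_ne_zero_of_mul h0) (right_ne_zero_of_mul h0)] at h1
        refine ⟨coeff 0 u, ?_⟩
        rw [← totalDegree_eq_zero_iff_eq_C.1 (by omega : u.totalDegree = 0), mul_comm]
    obtain ⟨a, ha⟩ := key hf (pgcd_dvd_left f g)
    obtain ⟨b, hb⟩ := key hg (pgcd_dvd_right f g)
    have := hi b (-a) (by
      nth_rewrite 1 [ha]
      nth_rewrite 2 [hb]
      rw [C_neg]; ring)
    rw [neg_eq_zero] at this
    rw [this.2, C_0, zero_mul] at ha
    rw [this.1, C_0, zero_mul] at hb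
    simp [ha, hb] at h

theorem rep_div_injective {d d' : CP1} (h : d.rep 0 * d'.rep 1 = d'.rep 0 * d.rep 1) : d = d' := by
  rw [← d.mk_rep, ← d'.mk_rep, Projectivization.mk_eq_mk_iff']
  by_cases h0 : d'.rep 0 = 0
  · have h1 := rep_one_ne_zero h0
    rw [h0, zero_mul, mul_eq_zero] at h
    refine ⟨d.rep 1 / d'.rep 1, ?_⟩
    ext i
    fin_cases i
    · simp [h0, h.resolve_right h1]
    · simp [h1]
  · refine ⟨d.rep 0 / d'.rep 0, ?_⟩
    ext i
    fin_cases i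
    · simp [h0]
    · simp only [Fin.mk_one, Pi.smul_apply, smul_eq_mul]
      field_simp
      linear_combination h

/-- The restriction of a binary form to the line `x = 1`. -/
def restrictLine (f : LocalPoly) : Polynomial ℂ := aeval ![1, Polynomial.X] f

theorem eval_restrictLine (f : LocalPoly) (t : ℂ) :
    (restrictLine f).eval t = eval ![1, t] f := by
  rw [restrictLine, ← Polynomial.coe_evalRingHom, ← coe_aeval_eq_eval, ← Polynomial.coe_aeval_eq_evalRingHom]
  simp only [RingHom.coe_coe]
  rw [← AlgHom.comp_apply, comp_aeval]
  congr 2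
  funext i
  fin_cases i <;> simp

theorem eval_eq_restrictLine {f : LocalPoly} {m : ℕ} (hf : f.IsHomogeneous m) {v : Fin 2 → ℂ}
    (hv : v 0 ≠ 0) : eval v f = v 0 ^ m * (restrictLine f).eval (v 1 / v 0) := by
  rw [eval_restrictLine, ← eval_smul_of_isHomogeneous hf]
  congr 2
  funext i
  fin_cases i <;> simp; field_simp

theorem eq_C_mul_X_pow_of_restrictLine_eq_C {f : LocalPoly} {m : ℕ} (hf : f.IsHomogeneous m)
    {c : ℂ} (h : restrictLine f = Polynomial.C c) : f = C c * X 0 ^ m := by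
  refine mul_right_cancel₀ (X_ne_zero (0 : Fin 2)) (MvPolynomial.funext fun v => ?_)
  simp only [map_mul, map_pow, eval_X, eval_C]
  by_cases hv : v 0 = 0
  · rw [hv, mul_zero, mul_zero]
  · rw [eval_eq_restrictLine hf hv, h, Polynomial.eval_C]; ring

theorem exists_eval_rep_eq_zero_of_eval {f : LocalPoly} {m : ℕ} (hf : f.IsHomogeneous m)
    {v : Fin 2 → ℂ} (hv : v ≠ 0) (h : eval v f = 0) : ∃ d : CP1, eval d.rep f = 0 := by
  obtain ⟨a, ha⟩ := Projectivization.exists_smul_eq_mk_rep ℂ v hv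
  refine ⟨Projectivization.mk ℂ v hv, ?_⟩
  rw [← ha]
  have := eval_smul_of_isHomogeneous hf a v
  rw [h, mul_zero] at this
  exact this

theorem exists_eval_rep_eq_zero {f : LocalPoly} {m : ℕ} (hf : f.IsHomogeneous m) (hm : 0 < m) :
    ∃ d : CP1, eval d.rep f = 0 := by
  -- The zero polynomial has degree `⊥` and falls under the second case, where a root exists. Degree
  -- `0` means that the form is a multiple of `x ^ m`, which vanishes in the direction `[0 : 1]`.
  by_cases h : (restrictLine f).degree = 0
  · have := eq_C_mul_X_pow_of_restrictLine_eq_C hf (Polynomial.eq_C_of_degree_eq_zero h)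
    refine exists_eval_rep_eq_zero_of_eval hf (v := ![0, 1]) (fun h => by simpa using congrFun h 1) ?_
    rw [this]
    simp [hm.ne']
  · obtain ⟨t, ht⟩ := IsAlgClosed.exists_root _ h
    refine exists_eval_rep_eq_zero_of_eval hf (v := ![1, t]) (fun h => by simpa using congrFun h 0) ?_
    rw [← eval_restrictLine]
    exact ht

theorem finite_eval_rep_eq_zero {f : LocalPoly} {m : ℕ} (hf : f.IsHomogeneous m) (h : f ≠ 0) :
    {d : CP1 | eval d.rep f = 0}.Finite := by
  have hp : restrictLine f ≠ 0 := by
    intro h0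
    refine h ?_
    rw [eq_C_mul_X_pow_of_restrictLine_eq_C hf (c := 0) (by rw [h0, Polynomial.C_0]), C_0, zero_mul]
  have h1 : {d : CP1 | d.rep 0 = 0}.Subsingleton := fun d hd d' hd' =>
    rep_div_injective (by rw [hd, hd', zero_mul, zero_mul])
  have h2 : {d : CP1 | d.rep 0 ≠ 0 ∧ (restrictLine f).IsRoot (d.rep 1 / d.rep 0)}.Finite := by
    refine Set.Finite.of_finite_image (f := fun d : CP1 => d.rep 1 / d.rep 0)
      ((Polynomial.finite_setOfPred_isRoot hp).subset ?_) ?_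
    · rintro _ ⟨d, hd, rfl⟩
      exact hd.2
    · rintro d ⟨hd, -⟩ d' ⟨hd', -⟩ heq
      refine rep_div_injective ?_
      field_simp at heq
      linear_combination -heq
  refine (h1.finite.union h2).subset fun d hd => ?_
  by_cases h0 : d.rep 0 = 0
  · exact Or.inl h0
  · refine Or.inr ⟨h0, ?_⟩
    rw [Set.mem_ofPred_eq, eval_eq_restrictLine hf h0] at hd
    exact (mul_eq_zero.1 hd).resolve_left (pow_ne_zero _ h0)

/-- Two proportional binary forms of positive degree have a common zero. -/
theorem exists_common_zero {f g : LocalPoly} {m : ℕ} (hf : f.IsHomogeneous m)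
    (hg : g.IsHomogeneous m) (hm : 0 < m) (h : ¬ Indep f g) :
    ∃ d : CP1, eval d.rep f = 0 ∧ eval d.rep g = 0 := by
  unfold Indep at h
  push Not at h
  obtain ⟨a, b, hab, hne⟩ := h
  have key : ∀ {p q : LocalPoly} {d : CP1}, p ∣ q → eval d.rep p = 0 → eval d.rep q = 0 := by
    rintro p _ d ⟨u, rfl⟩ h
    rw [map_mul, h, zero_mul]
  by_cases ha : a = 0
  · obtain ⟨d, hd⟩ := exists_eval_rep_eq_zero hf hm
    exact ⟨d, hd, key (dvd_of_C_mul_add_C_mul_eq_zero (hne ha)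
      (by rw [add_comm]; exact hab)) hd⟩
  · obtain ⟨d, hd⟩ := exists_eval_rep_eq_zero hg hm
    exact ⟨d, key (dvd_of_C_mul_add_C_mul_eq_zero ha hab) hd, hd⟩

/-! ### Transforms of forms -/

theorem pderiv_bind₁ {σ τ : Type} [Fintype σ] (φ : σ → MvPolynomial τ ℂ) (f : MvPolynomial σ ℂ)
    (j : τ) : pderiv j (bind₁ φ f) = ∑ i, bind₁ φ (pderiv i f) * pderiv j (φ i) := by
  classical
  induction f using MvPolynomial.induction_on with
  | C a => simp
  | add p q hp hq => simp only [map_add, hp, hq, add_mul, Finset.sum_add_distrib]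
  | mul_X p i hp =>
    rw [map_mul, pderiv_mul, hp, bind₁_X_right]
    simp only [pderiv_mul, map_add, map_mul, bind₁_X_right, pderiv_X, add_mul,
      Finset.sum_add_distrib]
    congr 1
    · rw [Finset.sum_mul]
      exact Finset.sum_congr rfl fun k _ => by ring
    · rw [Finset.sum_eq_single i]
      · simp
      · intro b _ hb; simp [hb]
      · simp

theorem pullback_wronskian (d : CP1) (f g : LocalPoly) (j : Fin 2) :
    pullback (blowUpMap d) (wronskian f g) j =
      wronskian (blowUpHom d f) (blowUpHom d g) j := by
  simp only [pullback, wronskian, blowUpHom, pderiv_bind₁, map_sub, map_mul, sub_mul,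
    Finset.sum_sub_distrib, Finset.mul_sum, mul_assoc]

theorem wronskian_mul (e f g : LocalPoly) (j : Fin 2) :
    wronskian (e * f) (e * g) j = e ^ 2 * wronskian f g j := by
  simp only [wronskian, pderiv_mul]; ring

theorem pullback_mul (d : CP1) (h : LocalPoly) {W ω : LocalForm} (hW : ∀ i, W i = h * ω i)
    (j : Fin 2) :
    pullback (blowUpMap d) W j = blowUpHom d h * pullback (blowUpMap d) ω j := by
  simp only [pullback, hW, map_mul, Finset.mul_sum, mul_assoc]
  rfl

theorem bind₁_dirMap_charPoly (d : CP1) (ω : LocalForm) : bind₁ (dirMap d) (charPoly ω) =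
    ∑ i, bind₁ (dirMap d) (homogeneousComponent (formMult ω) (ω i)) * dirMap d i := by
  simp only [charPoly, map_add, map_mul, bind₁_X_right, Fin.sum_univ_two]
  ring

-- Writing the blow-up as `e * u` with `e` the exceptional equation, `d(e u_i) = u_i de + e du_i`.
-- The lowest part of the coefficient of `de` is `charPoly ω` evaluated at `u`, so its vanishing
-- releases one more factor `e`.
open scoped Classical in
theorem exc_pow_mul_blowUpForm (d : CP1) (ω : LocalForm) (j : Fin 2) :
    exc d ^ (if charPoly ω = 0 then formMult ω + 1 else formMult ω) * blowUpForm d ω j =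
      pullback (blowUpMap d) ω j := by
  suffices h : exc d ^ (if charPoly ω = 0 then formMult ω + 1 else formMult ω) ∣
      pullback (blowUpMap d) ω j by
    obtain ⟨g, hg⟩ := h
    rw [blowUpForm, hg, divExc_exc_pow_mul]
  split_ifs with h
  · have h1 : ∀ i, ∃ g, blowUpHom d (ω i) = exc d ^ formMult ω *
        (bind₁ (dirMap d) (homogeneousComponent (formMult ω) (ω i)) + exc d * g) :=
      fun i => exists_blowUpHom_eq d (mem_ord_formMult ω i)
    choose g hg using h1
    have h2 := bind₁_dirMap_charPoly d ω
    rw [h, map_zero, Fin.sum_univ_two] at h2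
    refine ⟨g 0 * pderiv j (blowUpMap d 0) + g 1 * pderiv j (blowUpMap d 1) +
      bind₁ (dirMap d) (homogeneousComponent (formMult ω) (ω 0)) * pderiv j (dirMap d 0) +
      bind₁ (dirMap d) (homogeneousComponent (formMult ω) (ω 1)) * pderiv j (dirMap d 1), ?_⟩
    rw [pullback, Fin.sum_univ_two]
    change blowUpHom d (ω 0) * _ + blowUpHom d (ω 1) * _ = _
    rw [hg, hg, blowUpMap_eq, blowUpMap_eq, pderiv_mul, pderiv_mul]
    linear_combination -exc d ^ formMult ω * pderiv j (exc d) * h2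
  · exact Finset.dvd_sum fun i _ =>
      dvd_mul_of_dvd_left (exc_pow_dvd_blowUpHom d (mem_ord_formMult ω i)) _

/-- If a form is, up to a factor, the wronskian of two polynomials, then its strict transform is,
up to a factor, the wronskian of their transforms. -/
theorem exists_wronskian_transform_eq (d : CP1) {f g h : LocalPoly} {ω : LocalForm} {m : ℕ}
    (hf : f ∈ ord m) (hg : g ∈ ord m)
    (hm : homogeneousComponent m f ≠ 0 ∨ homogeneousComponent m g ≠ 0) (hfg : Indep f g)
    (hW : ∀ i, wronskian f g i = h * ω i) :
    ∃ h', ∀ i, wronskian (transform d m f) (transform d m g) i = h' * blowUpForm d ω i := by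
  classical
  have hle := two_mul_le_mult_add hf hg hm hfg hW
  have hform := exc_pow_mul_blowUpForm d ω
  set k := if charPoly ω = 0 then formMult ω + 1 else formMult ω
  obtain ⟨n, hn⟩ := Nat.exists_eq_add_of_le hle
  -- `n` is the surplus in `two_mul_le_mult_add`.
  refine ⟨exc d ^ n * transform d (mult h) h, fun i => ?_⟩
  refine mul_left_cancel₀ (pow_ne_zero (2 * m) (exc_ne_zero d)) ?_
  have h1 := pullback_mul d h hW i
  rw [pullback_wronskian, ← exc_pow_mul_transform d hf, ← exc_pow_mul_transform d hg,
    wronskian_mul, ← pow_mul, mul_comm m 2, ← hform i,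
    ← exc_pow_mul_transform d (mem_ord_mult h)] at h1
  have h2 := congrArg (exc d ^ ·) hn
  simp only [pow_add] at h2
  rw [h1]
  linear_combination transform d (mult h) h * blowUpForm d ω i * h2

theorem Indep.transform (d : CP1) {f g : LocalPoly} {m : ℕ} (hf : f ∈ ord m) (hg : g ∈ ord m)
    (h : Indep f g) : Indep (transform d m f) (transform d m g) := by
  intro a b hab
  refine h a b ?_
  rw [← transform_C_mul, ← transform_C_mul, ← transform_add] at hab
  by_contra hne
  refine transform_ne_zero d ?_ hne hab
  rw [C_mul', C_mul']
  exact add_mem (Submodule.smul_mem _ _ hf) (Submodule.smul_mem _ _ hg)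

/-! ### Simple singularities are preserved by blowing up -/

/-- The condition on the eigenvalues of the linear part of a simple singularity. -/
def IsSimplePair (l₁ l₂ : ℂ) : Prop :=
  (l₁ * l₂ ≠ 0 ∧ ¬ ∃ q : ℚ, 0 < q ∧ l₁ / l₂ = (q : ℂ)) ∨ (l₁ * l₂ = 0 ∧ l₁ ^ 2 + l₂ ^ 2 ≠ 0)

theorem IsSimplePair.symm {a b : ℂ} (h : IsSimplePair a b) : IsSimplePair b a := by
  rcases h with ⟨h, hq⟩ | ⟨h, h'⟩
  · refine Or.inl ⟨by rwa [mul_comm], ?_⟩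
    rintro ⟨q, hq0, hq'⟩
    refine hq ⟨q⁻¹, inv_pos.2 hq0, ?_⟩
    rw [Rat.cast_inv, ← hq', inv_div]
  · exact Or.inr ⟨by rwa [mul_comm], by rwa [add_comm]⟩

theorem isSimplePair_neg {a : ℂ} (h : a ≠ 0) : IsSimplePair a (-a) := by
  refine Or.inl ⟨mul_ne_zero h (neg_ne_zero.2 h), ?_⟩
  rintro ⟨q, hq, h'⟩
  rw [div_neg, div_self h] at h'
  have : (-1 : ℚ) = q := by exact_mod_cast h'
  linarith

theorem not_isSimplePair_self (a : ℂ) : ¬ IsSimplePair a a := by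
  rintro (⟨h, hq⟩ | ⟨h, h'⟩)
  · exact hq ⟨1, one_pos, by rw [div_self (left_ne_zero_of_mul h), Rat.cast_one]⟩
  · rw [mul_self_eq_zero] at h
    simp [h] at h'

/-- Blowing up an eigendirection of eigenvalue `a` changes the eigenvalues `a`, `b` into `a`, `b -
a`. For non-zero `a` the ratio drops by one, and it cannot become a positive rational unless it was
one. -/
theorem IsSimplePair.sub {a b : ℂ} (h : IsSimplePair a b) : IsSimplePair a (b - a) := by
  by_cases ha : a = 0
  · rwa [ha, sub_zero, ← ha]
  by_cases hb : b = 0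
  · rw [hb, zero_sub]; exact isSimplePair_neg ha
  rcases h.symm with ⟨h, hq⟩ | ⟨h, -⟩
  · refine IsSimplePair.symm (Or.inl ⟨mul_ne_zero (sub_ne_zero.2 ?_) ha, ?_⟩)
    · rintro rfl
      exact hq ⟨1, one_pos, by rw [div_self ha, Rat.cast_one]⟩
    · rintro ⟨q, hq0, hq'⟩
      refine hq ⟨q + 1, by linarith, ?_⟩
      rw [sub_div, div_self ha] at hq'
      rw [Rat.cast_add, ← hq', Rat.cast_one, sub_add_cancel]
  · exact absurd h (mul_ne_zero hb ha)

/-- The coefficient of a coordinate in a polynomial. -/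
def lin (i : Fin 2) (f : LocalPoly) : ℂ := coeff (Finsupp.single i 1) f

theorem lin_eq (i : Fin 2) (f : LocalPoly) : lin i f = constantCoeff (pderiv i f) := by
  change coeff _ _ = coeff 0 _
  simp [coeff_pderiv]

theorem lin_add (i : Fin 2) (f g : LocalPoly) : lin i (f + g) = lin i f + lin i g :=
  coeff_add _ _ _

theorem lin_C (i : Fin 2) (a : ℂ) : lin i (C a) = 0 := by rw [lin_eq, pderiv_C, map_zero]

theorem lin_X (i j : Fin 2) : lin i (X j) = if j = i then 1 else 0 := by
  rw [lin_eq, pderiv_X, Pi.single_apply]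
  split_ifs <;> simp_all

theorem lin_mul (i : Fin 2) (f g : LocalPoly) :
    lin i (f * g) = lin i f * constantCoeff g + constantCoeff f * lin i g := by
  rw [lin_eq, pderiv_mul, map_add, map_mul, map_mul, ← lin_eq, ← lin_eq]

theorem homogeneousComponent_one (f : LocalPoly) :
    homogeneousComponent 1 f = C (lin 0 f) * X 0 + C (lin 1 f) * X 1 := by
  have := homogeneousComponent_euler f 1
  rw [one_smul] at this
  rw [← this, euler, map_add, homogeneousComponent_X_mul, homogeneousComponent_X_mul,
    homogeneousComponent_zero, homogeneousComponent_zero, lin_eq, lin_eq]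
  simp only [mul_comm (X _)]
  rfl

theorem blowUpHom_eq_add (d : CP1) (f : LocalPoly) : ∃ q, blowUpHom d f =
    C (constantCoeff f) + exc d * (C (lin 0 f) * dirMap d 0 + C (lin 1 f) * dirMap d 1) +
      exc d ^ 2 * q := by
  have h : f - homogeneousComponent 0 f - homogeneousComponent 1 f ∈ ord 2 := by
    intro j hj
    rw [map_sub, map_sub, homogeneousComponent_of_mem (homogeneousComponent_isHomogeneous 0 f),
      homogeneousComponent_of_mem (homogeneousComponent_isHomogeneous 1 f)]
    interval_cases j <;> simp
  obtain ⟨q, hq⟩ := exc_pow_dvd_blowUpHom d h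
  refine ⟨q, ?_⟩
  rw [← hq, map_sub, map_sub, blowUpHom_of_isHomogeneous d (homogeneousComponent_isHomogeneous 1 f),
    homogeneousComponent_one, homogeneousComponent_zero]
  simp only [blowUpHom, bind₁_C_right, map_add, map_mul, bind₁_X_right, pow_one]
  change _ = C (coeff 0 f) + _ + _
  ring

theorem linearPart_trace (ω : LocalForm) :
    (linearPart ω).trace = lin 0 (ω 1) - lin 1 (ω 0) := by
  simp [linearPart, lin, Matrix.trace_fin_two, sub_eq_add_neg]

theorem linearPart_det (ω : LocalForm) :
    (linearPart ω).det = lin 1 (ω 1) * lin 0 (ω 0) - lin 0 (ω 1) * lin 1 (ω 0) := by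
  simp [linearPart, lin, Matrix.det_fin_two]
  ring

theorem roots_charpoly_eq_iff (M : Matrix (Fin 2) (Fin 2) ℂ) (a b : ℂ) :
    M.charpoly.roots = {a, b} ↔ M.trace = a + b ∧ M.det = a * b := by
  constructor
  · intro h
    rw [Matrix.trace_eq_sum_roots_charpoly, Matrix.det_eq_prod_roots_charpoly, h]
    simp
  · rintro ⟨h1, h2⟩
    have : M.charpoly = (Multiset.map (fun x => Polynomial.X - Polynomial.C x) {a, b}).prod := by
      rw [Matrix.charpoly_fin_two, h1, h2]
      simp
      ring
    rw [this, Polynomial.roots_multiset_prod_X_sub_C]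

theorem isSimple_of_isSimplePair {ω : LocalForm} (h0 : IsSingular ω) {a b : ℂ}
    (htr : lin 0 (ω 1) - lin 1 (ω 0) = a + b)
    (hdet : lin 1 (ω 1) * lin 0 (ω 0) - lin 0 (ω 1) * lin 1 (ω 0) = a * b)
    (hab : IsSimplePair a b) : IsSimple ω := by
  refine ⟨h0, formMult_eq (fun i => ?_) ?_, a, b, ?_, hab⟩
  · exact mem_ord_succ (mem_ord_zero _) (homogeneousComponent_zero_eq_zero_iff.2 (h0 i))
  · by_contra! h
    have h1 : ∀ i j, lin j (ω i) = 0 := by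
      intro i j
      have := congrArg (coeff (Finsupp.single j 1)) (h i)
      rwa [coeff_homogeneousComponent, if_pos (Finsupp.degree_single _ _), coeff_zero] at this
    simp only [h1] at htr hdet
    have ha : a * a = 0 := by linear_combination -a * htr + hdet
    rw [mul_self_eq_zero] at ha
    have hb : b = 0 := by rw [ha] at htr; simpa using htr.symm
    rw [ha, hb] at hab
    exact not_isSimplePair_self 0 hab
  · rw [roots_charpoly_eq_iff, linearPart_trace, linearPart_det]
    exact ⟨htr, hdet⟩

/-- In multiplicity one, a vanishing characteristic polynomial makes the linear part scalar, and
equal eigenvalues are never simple. -/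
theorem IsSimple.charPoly_ne_zero {ω : LocalForm} (h : IsSimple ω) : charPoly ω ≠ 0 := by
  obtain ⟨-, hm, a, b, hr, hab⟩ := h
  intro h0
  rw [charPoly, hm, homogeneousComponent_one, homogeneousComponent_one] at h0
  have h1 := congrArg (eval ![1, 0]) h0
  have h2 := congrArg (eval ![0, 1]) h0
  have h3 := congrArg (eval ![1, 1]) h0
  simp at h1 h2 h3
  rw [roots_charpoly_eq_iff, linearPart_trace, linearPart_det] at hr
  rw [h1, h2] at hr
  -- This is the discriminant, trace squared minus four times the determinant.
  have hab' : (a - b) * (a - b) = 0 := by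
    have h4 : lin 1 (ω 0) = - lin 0 (ω 1) := by
      rw [h1, h2] at h3
      linear_combination h3
    obtain ⟨e1, e2⟩ := hr
    rw [h4] at e1 e2
    linear_combination (2 * lin 0 (ω 1) + (a + b)) * (-1) * e1 + 4 * e2
  rw [mul_self_eq_zero, sub_eq_zero] at hab'
  rw [hab'] at hab
  exact not_isSimplePair_self b hab

theorem isSingular_of_charPoly_eq_zero {ω : LocalForm} (h : charPoly ω = 0) : IsSingular ω := by
  intro i
  rcases Nat.eq_zero_or_eq_succ_pred (formMult ω) with h0 | h0
  · rw [charPoly, h0, homogeneousComponent_zero, homogeneousComponent_zero] at h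
    have h1 := congrArg (eval ![1, 0]) h
    have h2 := congrArg (eval ![0, 1]) h
    simp at h1 h2
    fin_cases i
    · exact h1
    · exact h2
  · have := mem_ord_formMult ω i
    rw [h0] at this
    exact constantCoeff_eq_zero_of_mem_ord this

theorem isOrdinary_of_charPoly_eq_zero {ω : LocalForm} (h : charPoly ω = 0) : IsOrdinary ω :=
  ⟨isSingular_of_charPoly_eq_zero h, fun hs => hs.charPoly_ne_zero h⟩

theorem formMult_eq_zero_of_not_isSingular {ω : LocalForm} (h : ¬ IsSingular ω) :
    formMult ω = 0 := by
  refine formMult_eq (fun i => mem_ord_zero _) ?_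
  unfold IsSingular at h
  push Not at h
  obtain ⟨i, hi⟩ := h
  exact ⟨i, fun h0 => hi (homogeneousComponent_zero_eq_zero_iff.1 h0)⟩

theorem exc_pow_formMult_mul_blowUpForm (d : CP1) {ω : LocalForm} (h : charPoly ω ≠ 0)
    (j : Fin 2) : exc d ^ formMult ω * blowUpForm d ω j =
      blowUpHom d (ω 0) * pderiv j (blowUpMap d 0) +
        blowUpHom d (ω 1) * pderiv j (blowUpMap d 1) := by
  have := exc_pow_mul_blowUpForm d ω j
  rw [if_neg h, pullback, Fin.sum_univ_two] at this
  exact this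

theorem not_isOrdinary_of_coeffs {η : LocalForm} (a b : ℂ)
    (h : IsSingular η → (lin 0 (η 1) - lin 1 (η 0) = a + b ∧
      lin 1 (η 1) * lin 0 (η 0) - lin 0 (η 1) * lin 1 (η 0) = a * b ∧ IsSimplePair a b)) :
    ¬ IsOrdinary η := fun ⟨h1, h2⟩ =>
  h2 (isSimple_of_isSimplePair h1 (h h1).1 (h h1).2.1 (h h1).2.2)

/-- The only possible singularity on the exceptional divisor is in the direction tangent to the
leaf, with opposite eigenvalues. -/
theorem not_isOrdinary_blowUpForm_of_not_isSingular (d : CP1) {ω : LocalForm}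
    (h : ¬ IsSingular ω) : ¬ IsOrdinary (blowUpForm d ω) := by
  have hc : charPoly ω ≠ 0 := fun h0 => h (isSingular_of_charPoly_eq_zero h0)
  have key := exc_pow_formMult_mul_blowUpForm d hc
  rw [formMult_eq_zero_of_not_isSingular h] at key
  simp only [pow_zero, one_mul] at key
  obtain ⟨p, hp⟩ := blowUpHom_eq_add d (ω 0)
  obtain ⟨q, hq⟩ := blowUpHom_eq_add d (ω 1)
  rw [hp, hq] at key
  have hne : constantCoeff (ω 0) ≠ 0 ∨ constantCoeff (ω 1) ≠ 0 := by
    by_contra! h'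
    exact h fun i => by fin_cases i; exacts [h'.1, h'.2]
  by_cases hd : d.rep 0 = 0
  · simp only [exc, excIndex, dirMap, blowUpMap, hd, ne_eq, not_true_eq_false, if_false] at key
    have k0 := key 0
    have k1 := key 1
    simp [pderiv_X] at k0 k1
    refine not_isOrdinary_of_coeffs (constantCoeff (ω 0)) (-constantCoeff (ω 0)) fun hs => ?_
    have h1 := hs 1
    rw [k1] at h1
    simp at h1
    refine ⟨?_, ?_, isSimplePair_neg (hne.resolve_right (not_not.2 h1))⟩
    · simp [k0, k1, lin_add, lin_mul, lin_X, lin_C, pow_two]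
    · simp [k0, k1, lin_add, lin_mul, lin_X, lin_C, pow_two]
  · simp only [exc, excIndex, dirMap, blowUpMap, hd, ne_eq, not_false_eq_true, if_true] at key
    have k0 := key 0
    have k1 := key 1
    simp [pderiv_X] at k0 k1
    refine not_isOrdinary_of_coeffs (constantCoeff (ω 1)) (-constantCoeff (ω 1)) fun hs => ?_
    have h1 := hs 0
    rw [k0] at h1
    simp at h1
    have h2 : constantCoeff (ω 1) ≠ 0 := by
      rcases hne with hne | hne
      · intro h0
        rw [h0] at h1
        simp at h1
        exact hne h1
      · exact hne
    refine ⟨?_, ?_, isSimplePair_neg h2⟩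
    · simp [k0, k1, lin_add, lin_mul, lin_X, lin_C, pow_two]
    · simp [k0, k1, lin_add, lin_mul, lin_X, lin_C, pow_two]

theorem not_isOrdinary_blowUpForm_of_isSimple (d : CP1) {ω : LocalForm}
    (h : IsSimple ω) : ¬ IsOrdinary (blowUpForm d ω) := by
  have key := exc_pow_formMult_mul_blowUpForm d h.charPoly_ne_zero
  obtain ⟨h0, hm, a, b, hr, hab⟩ := h
  rw [roots_charpoly_eq_iff, linearPart_trace, linearPart_det] at hr
  obtain ⟨htr, hdet⟩ := hr
  rw [hm] at key
  obtain ⟨p, hp⟩ := blowUpHom_eq_add d (ω 0)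
  obtain ⟨q, hq⟩ := blowUpHom_eq_add d (ω 1)
  rw [hp, hq, h0 0, h0 1] at key
  have hpair : ∀ {μ ν : ℂ}, μ + ν = a + b → μ * ν = a * b → IsSimplePair μ ν := by
    intro μ ν h1 h2
    have : (μ - a) * (μ - b) = 0 := by linear_combination μ * h1 - h2
    rcases mul_eq_zero.1 this with h | h
    · rw [sub_eq_zero] at h
      rw [h, add_right_inj] at h1
      rwa [h, h1]
    · rw [sub_eq_zero] at h
      rw [h, add_comm a, add_right_inj] at h1
      rw [h, h1]
      exact IsSimplePair.symm hab
  by_cases hd : d.rep 0 = 0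
  · simp only [exc, excIndex, dirMap, blowUpMap, hd, ne_eq, not_true_eq_false, if_false] at key
    have k0 : blowUpForm d ω 0 = X 1 * (C (lin 0 (ω 0)) * X 0 + C (lin 1 (ω 0)) + X 1 * p) := by
      refine mul_left_cancel₀ (X_ne_zero (1 : Fin 2)) ?_
      rw [← pow_one (X 1), key 0]
      simp [pderiv_X]
      ring
    have k1 : blowUpForm d ω 1 = X 0 * (C (lin 0 (ω 0)) * X 0 + C (lin 1 (ω 0)) + X 1 * p) +
        (C (lin 0 (ω 1)) * X 0 + C (lin 1 (ω 1)) + X 1 * q) := by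
      refine mul_left_cancel₀ (X_ne_zero (1 : Fin 2)) ?_
      rw [← pow_one (X 1), key 1]
      simp [pderiv_X]
      ring
    -- A singular point of the divisor is an eigendirection, here that of `∂/∂y`, with eigenvalue
    -- `-lin 1 (ω 0)`. The new linear part is triangular, and the remainders `p`, `q` do not reach
    -- its diagonal.
    refine not_isOrdinary_of_coeffs (-lin 1 (ω 0)) (lin 0 (ω 1) - -lin 1 (ω 0)) fun hs => ?_
    have h1 := hs 1
    rw [k1] at h1
    simp at h1
    refine ⟨?_, ?_, IsSimplePair.sub (hpair (by linear_combination htr) ?_)⟩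
    · simp [k0, k1, lin_add, lin_mul, lin_X, lin_C]
    · simp [k0, k1, lin_add, lin_mul, lin_X, lin_C]
      ring
    · rw [h1] at hdet
      linear_combination hdet
  · simp only [exc, excIndex, dirMap, blowUpMap, hd, ne_eq, not_false_eq_true, if_true] at key
    set c := d.rep 1 / d.rep 0
    have k0 : blowUpForm d ω 0 = C (lin 0 (ω 0)) + C (lin 1 (ω 0)) * (X 1 + C c) + X 0 * p +
        (X 1 + C c) * (C (lin 0 (ω 1)) + C (lin 1 (ω 1)) * (X 1 + C c) + X 0 * q) := by
      refine mul_left_cancel₀ (X_ne_zero (0 : Fin 2)) ?_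
      rw [← pow_one (X 0), key 0]
      simp [pderiv_X]
      ring
    have k1 : blowUpForm d ω 1 = X 0 * (C (lin 0 (ω 1)) + C (lin 1 (ω 1)) * (X 1 + C c) +
        X 0 * q) := by
      refine mul_left_cancel₀ (X_ne_zero (0 : Fin 2)) ?_
      rw [← pow_one (X 0), key 1]
      simp [pderiv_X]
      ring
    -- The first number is the eigenvalue of the direction `(1, c)`, and the other old eigenvalue is
    -- the trace minus it.
    refine not_isOrdinary_of_coeffs (lin 0 (ω 1) + lin 1 (ω 1) * c)
      ((-lin 1 (ω 0) - lin 1 (ω 1) * c) - (lin 0 (ω 1) + lin 1 (ω 1) * c)) fun hs => ?_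
    have h1 := hs 0
    rw [k0] at h1
    simp at h1
    refine ⟨?_, ?_, IsSimplePair.sub (hpair (by linear_combination htr) ?_)⟩
    · simp [k0, k1, lin_add, lin_mul, lin_X, lin_C]
      ring
    · simp [k0, k1, lin_add, lin_mul, lin_X, lin_C]
      ring
    · linear_combination hdet - lin 1 (ω 1) * h1

theorem not_isOrdinary_blowUpForm (d : CP1) {ω : LocalForm} (h : ¬ IsOrdinary ω) :
    ¬ IsOrdinary (blowUpForm d ω) := by
  by_cases h1 : IsSingular ω
  · exact not_isOrdinary_blowUpForm_of_isSimple d (by_contra fun h2 => h ⟨h1, h2⟩)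
  · exact not_isOrdinary_blowUpForm_of_not_isSingular d h1

/-! ### Elimination -/

section Elimination

-- Gauss's lemma: the primitive part of a gcd over the fraction field already divides both
-- polynomials over `B`.
open Polynomial in
theorem isCoprime_map_of_isRelPrime {B K : Type*} [CommRing B] [IsDomain B]
    [UniqueFactorizationMonoid B] [Field K] [Algebra B K] [IsFractionRing B K] {p q : B[X]}
    (h : IsRelPrime p q) : IsCoprime (p.map (algebraMap B K)) (q.map (algebraMap B K)) := by
  classical
  let : NormalizedGCDMonoid B := Classical.arbitrary _
  by_cases h0 : p = 0 ∧ q = 0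
  · rw [h0.1, h0.2] at h
    exact absurd (h dvd_rfl dvd_rfl) not_isUnit_zero
  have hinj := Polynomial.map_injective (algebraMap B K) (IsFractionRing.injective B K)
  rw [← EuclideanDomain.gcd_isUnit_iff]
  set g := EuclideanDomain.gcd (p.map (algebraMap B K)) (q.map (algebraMap B K)) with hg
  have hg0 : g ≠ 0 := by
    intro hz
    rw [hg, EuclideanDomain.gcd_eq_zero_iff] at hz
    exact h0 ⟨hinj (by rw [hz.1, Polynomial.map_zero]), hinj (by rw [hz.2, Polynomial.map_zero])⟩
  obtain ⟨c, hc, hcg⟩ := IsLocalization.integerNormalization_spec (nonZeroDivisors B) g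
  set G := IsLocalization.integerNormalization (nonZeroDivisors B) g
  have hdvd : G.primPart.map (algebraMap B K) ∣ g := by
    have h1 : IsUnit (Polynomial.C (algebraMap B K c)) := by
      rw [Polynomial.isUnit_C, isUnit_iff_ne_zero]
      exact (map_ne_zero_iff _ (IsFractionRing.injective B K)).2 (nonZeroDivisors.ne_zero hc)
    rw [← h1.dvd_mul_left]
    rw [Algebra.smul_def, Polynomial.algebraMap_apply] at hcg
    rw [← hcg]
    exact Polynomial.map_dvd _ G.primPart_dvd
  have hprim := G.isPrimitive_primPart
  have hu : IsUnit G.primPart := h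
    (hprim.dvd_of_fraction_map_dvd_fraction_map
      (hdvd.trans (EuclideanDomain.gcd_dvd_left _ _)))
    (hprim.dvd_of_fraction_map_dvd_fraction_map
      (hdvd.trans (EuclideanDomain.gcd_dvd_right _ _)))
  exact isUnit_or_eq_zero_of_isUnit_integerNormalization_primPart hg0 hu

-- A Bézout relation over the fraction field, with denominators cleared; the constant `r` plays the
-- role of the resultant.
open Polynomial in
theorem exists_mul_add_mul_eq_C {B : Type*} [CommRing B] [IsDomain B]
    [UniqueFactorizationMonoid B] {p q : B[X]} (h : IsRelPrime p q) :
    ∃ (u v : B[X]) (r : B), r ≠ 0 ∧ u * p + v * q = Polynomial.C r := by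
  let K := FractionRing B
  obtain ⟨U, V, hUV⟩ := isCoprime_map_of_isRelPrime (K := K) h
  obtain ⟨c, hc, hcU⟩ := IsLocalization.integerNormalization_spec (nonZeroDivisors B) U
  obtain ⟨c', hc', hcV⟩ := IsLocalization.integerNormalization_spec (nonZeroDivisors B) V
  refine ⟨Polynomial.C c' * IsLocalization.integerNormalization (nonZeroDivisors B) U,
    Polynomial.C c * IsLocalization.integerNormalization (nonZeroDivisors B) V, c * c',
    mul_ne_zero (nonZeroDivisors.ne_zero hc) (nonZeroDivisors.ne_zero hc'), ?_⟩
  refine Polynomial.map_injective (algebraMap B K) (IsFractionRing.injective B K) ?_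
  rw [Algebra.smul_def, Polynomial.algebraMap_apply] at hcU hcV
  simp only [Polynomial.map_add, Polynomial.map_mul, hcU, hcV, Polynomial.map_C, map_mul]
  linear_combination Polynomial.C (algebraMap B K c) * Polynomial.C (algebraMap B K c') * hUV

/-- Polynomials in `n + 1` variables as polynomials in the variable `l`. -/
def asPolynomial {n : ℕ} (l : Fin (n + 1)) :
    MvPolynomial (Fin (n + 1)) ℂ ≃ₐ[ℂ] Polynomial (MvPolynomial (Fin n) ℂ) :=
  (renameEquiv ℂ (finSuccEquiv' l)).trans (optionEquivLeft ℂ (Fin n))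

theorem asPolynomial_rename {n : ℕ} (l : Fin (n + 1)) (R : MvPolynomial (Fin n) ℂ) :
    asPolynomial l (rename l.succAbove R) = Polynomial.C R := by
  induction R using MvPolynomial.induction_on with
  | C a => simp [asPolynomial]
  | add p q hp hq => rw [map_add, map_add, hp, hq, Polynomial.C_add]
  | mul_X p i hp =>
    rw [map_mul, map_mul, hp, Polynomial.C_mul]
    simp [asPolynomial]

theorem exists_rename_mem_span {n : ℕ} (l : Fin (n + 1)) {F G : MvPolynomial (Fin (n + 1)) ℂ}
    (h : IsRelPrime F G) : ∃ R : MvPolynomial (Fin n) ℂ, R ≠ 0 ∧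
      rename l.succAbove R ∈ Ideal.span {F, G} := by
  have h' : IsRelPrime (asPolynomial l F) (asPolynomial l G) := by
    intro d hF hG
    have h1 := h (d := (asPolynomial l).symm d)
      (by simpa using map_dvd (asPolynomial l).symm hF)
      (by simpa using map_dvd (asPolynomial l).symm hG)
    simpa using h1.map (asPolynomial l)
  obtain ⟨u, v, r, hr, huv⟩ := exists_mul_add_mul_eq_C h'
  refine ⟨r, hr, Ideal.mem_span_pair.2 ⟨(asPolynomial l).symm u, (asPolynomial l).symm v, ?_⟩⟩
  refine (asPolynomial l).injective ?_
  rw [map_add, map_mul, map_mul, AlgEquiv.apply_symm_apply, AlgEquiv.apply_symm_apply, huv,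
    asPolynomial_rename]

-- The ideal is homogeneous, so it contains the components of an eliminant. Homogeneity ensures that
-- setting a variable equal to `1` does not kill it.
attribute [local instance] MvPolynomial.gradedAlgebra in
theorem exists_isHomogeneous_rename_mem_span {n d : ℕ} (l : Fin (n + 1))
    {F G : MvPolynomial (Fin (n + 1)) ℂ} (hF : F.IsHomogeneous d) (hG : G.IsHomogeneous d)
    (h : IsRelPrime F G) : ∃ (e : ℕ) (R : MvPolynomial (Fin n) ℂ), R.IsHomogeneous e ∧ R ≠ 0 ∧
      rename l.succAbove R ∈ Ideal.span {F, G} := by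
  obtain ⟨R, hR, hmem⟩ := exists_rename_mem_span l h
  have : ∃ e, homogeneousComponent e R ≠ 0 := by
    by_contra! h0
    exact hR (by rw [← sum_homogeneousComponent R]; exact Finset.sum_eq_zero fun i _ => h0 i)
  obtain ⟨e, he⟩ := this
  refine ⟨e, homogeneousComponent e R, homogeneousComponent_isHomogeneous e R, he, ?_⟩
  rw [rename_homogeneousComponent]
  refine homogeneousComponent_mem_of_mem (Ideal.homogeneous_span _ _ ?_) hmem e
  rintro x (rfl | rfl)
  · exact ⟨d, hF⟩
  · exact ⟨d, hG⟩

/-- In an affine chart, the ideal of two homogeneous polynomials without common factor contains,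
for each coordinate, a non-zero polynomial in this coordinate. -/
theorem exists_aeval_mem_span {n : ℕ} {F G : MvPolynomial (Fin 3) ℂ} (hF : F.IsHomogeneous n)
    (hG : G.IsHomogeneous n) (h : IsRelPrime F G) (i : Fin 3) (j : Fin 2) :
    ∃ r : Polynomial ℂ, r ≠ 0 ∧ ∀ (B : Type) [CommRing B] [Algebra ℂ B] (v : Fin 3 → B),
      v i = 1 → Polynomial.aeval (v (i.succAbove j)) r ∈ Ideal.span {aeval v F, aeval v G} := by
  -- The other affine coordinate is eliminated. The variables left are `i`, to be set equal to `1`,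
  -- and the coordinate `j`.
  obtain ⟨j', hj'⟩ : ∃ j' : Fin 2, j' ≠ j := exists_ne j
  obtain ⟨e, R, hR, hR0, hmem⟩ :=
    exists_isHomogeneous_rename_mem_span (i.succAbove j') hF hG h
  obtain ⟨i₀, hi₀⟩ := Fin.exists_succAbove_eq (x := i) (y := i.succAbove j')
    (Fin.succAbove_ne _ _).symm
  obtain ⟨j₀, hj₀⟩ := Fin.exists_succAbove_eq (x := i.succAbove j) (y := i.succAbove j')
    (fun h => hj' (Fin.succAbove_right_injective h).symm)
  have hne : j₀ ≠ i₀ := by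
    rintro rfl
    exact Fin.succAbove_ne i j (hj₀.symm.trans hi₀)
  have hcases : ∀ k : Fin 2, k ≠ i₀ → k = j₀ := by
    intro k hk
    omega
  let r : Polynomial ℂ := aeval (fun k => if k = i₀ then 1 else Polynomial.X) R
  have hr : ∀ {B : Type} [CommRing B] [Algebra ℂ B] (b : B),
      Polynomial.aeval b r = aeval (fun k => if k = i₀ then 1 else b) R := by
    intro B _ _ b
    rw [← AlgHom.comp_apply, comp_aeval]
    congr 2
    funext k
    split_ifs <;> simp
  refine ⟨r, fun h0 => hR0 ?_, fun B _ _ v hv => ?_⟩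
  · refine (mul_eq_zero.1 (MvPolynomial.funext fun w => ?_ : R * X i₀ = 0)).resolve_right
      (X_ne_zero _)
    rw [map_mul, eval_X, map_zero]
    by_cases hw : w i₀ = 0
    · rw [hw, mul_zero]
    · have h1 := hr (w j₀ / w i₀)
      rw [h0, map_zero] at h1
      have h2 := eval_smul_of_isHomogeneous hR (w i₀) (fun k => if k = i₀ then 1 else w j₀ / w i₀)
      have h3 : (fun k => w i₀ * if k = i₀ then 1 else w j₀ / w i₀) = w := by
        funext k
        split_ifs with hk
        · rw [hk, mul_one]
        · rw [hcases k hk]; field_simp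
      rw [h3] at h2
      rw [h2]
      have h4 : ∀ u : Fin 2 → ℂ, aeval u R = eval u R := fun u => by
        rw [← coe_aeval_eq_eval]; rfl
      rw [← h4, ← h1, mul_zero, zero_mul]
  · have h1 : Polynomial.aeval (v (i.succAbove j)) r =
        aeval v (rename (i.succAbove j').succAbove R) := by
      rw [hr, aeval_rename]
      congr 2
      funext k
      split_ifs with hk
      · rw [hk, Function.comp_apply, hi₀, hv]
      · rw [hcases k hk, Function.comp_apply, hj₀]
    rw [h1]
    obtain ⟨a, b, hab⟩ := Ideal.mem_span_pair.1 hmem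
    rw [← hab, map_add, map_mul, map_mul]
    exact Ideal.mem_span_pair.2 ⟨_, _, rfl⟩

end Elimination

/-- Both coordinates become integral over `ℂ` in the quotient, which is then a finitely generated
integral algebra. -/
theorem colength_ne_top {f g : LocalPoly} (c : Fin 2 → ℂ)
    (h : ∀ j, ∃ r : Polynomial ℂ, r ≠ 0 ∧
      Polynomial.aeval (X j + C (c j) : LocalPoly) r ∈ Ideal.span {f, g}) :
    colength f g ≠ ⊤ := by
  set I := Ideal.span {f, g}
  have hX : ∀ j, IsIntegral ℂ (Ideal.Quotient.mkₐ ℂ I (X j)) := by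
    intro j
    obtain ⟨r, hr, hmem⟩ := h j
    have h1 : IsIntegral ℂ (Ideal.Quotient.mkₐ ℂ I (X j + C (c j))) := by
      rw [← isAlgebraic_iff_isIntegral]
      refine ⟨r, hr, ?_⟩
      rw [Polynomial.aeval_algHom_apply]
      exact Ideal.Quotient.eq_zero_iff_mem.2 hmem
    have h2 : Ideal.Quotient.mkₐ ℂ I (X j) =
        Ideal.Quotient.mkₐ ℂ I (X j + C (c j)) - algebraMap ℂ _ (c j) := by
      rw [map_add, ← AlgHom.commutes (Ideal.Quotient.mkₐ ℂ I), algebraMap_eq, add_sub_cancel_right]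
    rw [h2]
    exact h1.sub isIntegral_algebraMap
  have hint : Algebra.IsIntegral ℂ (LocalPoly ⧸ I) := by
    refine ⟨fun x => ?_⟩
    obtain ⟨p, rfl⟩ := Ideal.Quotient.mkₐ_surjective ℂ I x
    induction p using MvPolynomial.induction_on with
    | C a =>
      rw [← algebraMap_eq, AlgHom.commutes]
      exact isIntegral_algebraMap
    | add p q hp hq => rw [map_add]; exact hp.add hq
    | mul_X p i hp => rw [map_mul]; exact hp.mul (hX i)
  have hfin : Module.Finite ℂ (LocalPoly ⧸ I) := Algebra.IsIntegral.finite
  rw [colength, pencilIdeal, (Submodule.Quotient.restrictScalarsEquiv ℂ I).length_eq]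
  exact Module.length_ne_top

/-! ### Proper points -/

/-- The parametrization of the affine chart at a point. -/
def chartMap (P : CP2) : Fin 3 → LocalPoly :=
  (chartIndex P).insertNth (α := fun _ => LocalPoly) 1
    (fun j => X j + C (P.rep ((chartIndex P).succAbove j) / P.rep (chartIndex P)))

theorem chartMap_chartIndex (P : CP2) : chartMap P (chartIndex P) = 1 :=
  Fin.insertNth_apply_same _ _ _

theorem chartMap_succAbove (P : CP2) (j : Fin 2) : chartMap P ((chartIndex P).succAbove j) =
    X j + C (P.rep ((chartIndex P).succAbove j) / P.rep (chartIndex P)) :=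
  Fin.insertNth_apply_succAbove _ _ _ _

theorem rep_chartIndex_ne_zero (P : CP2) : P.rep (chartIndex P) ≠ 0 := by
  unfold chartIndex
  split_ifs with h2 h1
  · exact h2
  · exact h1
  · intro h0
    refine P.rep_nonzero ?_
    ext i
    fin_cases i
    · exact h0
    · exact not_not.1 h1
    · exact not_not.1 h2

theorem constantCoeff_chartMap (P : CP2) (k : Fin 3) :
    constantCoeff (chartMap P k) = P.rep k / P.rep (chartIndex P) := by
  by_cases hk : k = chartIndex P
  · rw [hk, chartMap_chartIndex, map_one, div_self (rep_chartIndex_ne_zero P)]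
  · obtain ⟨j, rfl⟩ := Fin.exists_succAbove_eq hk
    rw [chartMap_succAbove]
    simp

theorem dehomogenize_eq (P : CP2) (F : MvPolynomial (Fin 3) ℂ) :
    dehomogenize P F = bind₁ (chartMap P) F := rfl

theorem constantCoeff_dehomogenize (P : CP2) (F : MvPolynomial (Fin 3) ℂ) :
    constantCoeff (dehomogenize P F) = eval (fun k => P.rep k / P.rep (chartIndex P)) F := by
  rw [dehomogenize_eq, constantCoeff_bind₁]
  congr 2
  exact funext fun k => constantCoeff_chartMap P k

theorem eval_bind₁ {σ τ : Type} (w : τ → ℂ) (u : σ → MvPolynomial τ ℂ) (f : MvPolynomial σ ℂ) :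
    eval w (bind₁ u f) = eval (fun i => eval w (u i)) f := by
  induction f using MvPolynomial.induction_on with
  | C a => simp
  | add p q hp hq => rw [map_add, map_add, map_add, hp, hq]
  | mul_X p i hp => rw [map_mul, map_mul, map_mul, hp, bind₁_X_right, eval_X]

theorem eq_zero_of_dehomogenize_eq_zero (P : CP2) {F : MvPolynomial (Fin 3) ℂ} {n : ℕ}
    (hF : F.IsHomogeneous n) (h : dehomogenize P F = 0) : F = 0 := by
  refine (mul_eq_zero.1 (MvPolynomial.funext fun v => ?_ : F * X (chartIndex P) = 0)).resolve_right
    (X_ne_zero _)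
  rw [map_mul, eval_X, map_zero]
  by_cases hv : v (chartIndex P) = 0
  · rw [hv, mul_zero]
  · have h1 := congrArg (eval fun j => v ((chartIndex P).succAbove j) / v (chartIndex P) -
      P.rep ((chartIndex P).succAbove j) / P.rep (chartIndex P)) h
    rw [dehomogenize_eq, eval_bind₁, map_zero] at h1
    have h2 := eval_smul_of_isHomogeneous hF (v (chartIndex P)) (fun i => eval (fun j =>
      v ((chartIndex P).succAbove j) / v (chartIndex P) -
      P.rep ((chartIndex P).succAbove j) / P.rep (chartIndex P)) (chartMap P i))
    rw [h1, mul_zero] at h2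
    have h3 : v = fun i => v (chartIndex P) * eval (fun j =>
        v ((chartIndex P).succAbove j) / v (chartIndex P) -
        P.rep ((chartIndex P).succAbove j) / P.rep (chartIndex P)) (chartMap P i) := by
      funext k
      by_cases hk : k = chartIndex P
      · rw [hk, chartMap_chartIndex, map_one, mul_one]
      · obtain ⟨j, rfl⟩ := Fin.exists_succAbove_eq hk
        rw [chartMap_succAbove]
        simp
        field_simp
    rw [h3, h2, zero_mul]

theorem indep_of_isRelPrime {n : ℕ} (hn : 0 < n) {F G : MvPolynomial (Fin 3) ℂ}
    (hF : F.IsHomogeneous n) (hG : G.IsHomogeneous n) (h : IsRelPrime F G) : Indep F G := by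
  have key : ∀ {H : MvPolynomial (Fin 3) ℂ}, H.IsHomogeneous n → ¬ IsUnit H := by
    intro H hH hu
    have h1 := totalDegree_le_of_dvd (isUnit_iff_dvd_one.1 hu) one_ne_zero
    rw [hH.totalDegree hu.ne_zero, totalDegree_one] at h1
    omega
  intro a b hab
  refine ⟨?_, ?_⟩ <;> by_contra hne
  · exact key hG (h (dvd_of_C_mul_add_C_mul_eq_zero hne hab) dvd_rfl)
  · exact key hF (h dvd_rfl (dvd_of_C_mul_add_C_mul_eq_zero hne (by rw [add_comm]; exact hab)))

theorem Indep.dehomogenize {n : ℕ} {F G : MvPolynomial (Fin 3) ℂ} (hF : F.IsHomogeneous n)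
    (hG : G.IsHomogeneous n) (h : Indep F G) (P : CP2) :
    Indep (dehomogenize P F) (dehomogenize P G) := by
  intro a b hab
  refine h a b (eq_zero_of_dehomogenize_eq_zero P ((hF.C_mul a).add (hG.C_mul b)) ?_)
  simp only [dehomogenize_eq] at hab ⊢
  simpa using hab

theorem pderiv_dehomogenize (P : CP2) (F : MvPolynomial (Fin 3) ℂ) (j : Fin 2) :
    pderiv j (dehomogenize P F) = dehomogenize P (pderiv ((chartIndex P).succAbove j) F) := by
  rw [dehomogenize_eq, pderiv_bind₁, Fin.sum_univ_succAbove _ (chartIndex P), chartMap_chartIndex,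
    pderiv_one, mul_zero, zero_add, Finset.sum_eq_single j]
  · rw [chartMap_succAbove]
    simp [dehomogenize_eq]
  · intro k _ hk
    rw [chartMap_succAbove]
    simp [pderiv_X_of_ne hk]
  · simp

theorem wronskian_dehomogenize (F₁ F₂ : MvPolynomial (Fin 3) ℂ) (P : CP2) (j : Fin 2) :
    wronskian (dehomogenize P F₁) (dehomogenize P F₂) j =
      dehomogenize P (content (wronskianForm F₁ F₂)) *
        strictForm (pencilForm F₁ F₂) (.proper P) j := by
  have h := congrArg (dehomogenize P) (wronskianForm_eq F₁ F₂ ((chartIndex P).succAbove j))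
  rw [wronskian, pderiv_dehomogenize, pderiv_dehomogenize]
  simpa only [wronskianForm, strictForm, dehomogenize_eq, map_sub, map_mul] using h

theorem colength_dehomogenize_ne_top {n : ℕ} {F G : MvPolynomial (Fin 3) ℂ}
    (hF : F.IsHomogeneous n) (hG : G.IsHomogeneous n) (h : IsRelPrime F G) (P : CP2) :
    colength (dehomogenize P F) (dehomogenize P G) ≠ ⊤ := by
  refine colength_ne_top
    (fun j => P.rep ((chartIndex P).succAbove j) / P.rep (chartIndex P)) fun j => ?_
  obtain ⟨r, hr, hmem⟩ := exists_aeval_mem_span hF hG h (chartIndex P) j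
  refine ⟨r, hr, ?_⟩
  have := hmem LocalPoly (chartMap P) (chartMap_chartIndex P)
  rwa [chartMap_succAbove] at this

theorem finite_common_zeros {n : ℕ} {F G : MvPolynomial (Fin 3) ℂ}
    (hF : F.IsHomogeneous n) (hG : G.IsHomogeneous n) (h : IsRelPrime F G) :
    {P : CP2 | constantCoeff (dehomogenize P F) = 0 ∧
      constantCoeff (dehomogenize P G) = 0}.Finite := by
  have h1 : ∀ i : Fin 3, {P : CP2 | chartIndex P = i ∧ constantCoeff (dehomogenize P F) = 0 ∧
      constantCoeff (dehomogenize P G) = 0}.Finite := by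
    intro i
    choose r hr hmem using exists_aeval_mem_span hF hG h i
    let S : Set ℂ := {1} ∪ ⋃ j, {x | (r j).IsRoot x}
    have hS : S.Finite := (Set.finite_singleton 1).union
      (Set.finite_iUnion fun j => Polynomial.finite_setOfPred_isRoot (hr j))
    refine Set.Finite.of_finite_image (f := fun P : CP2 => fun k => P.rep k / P.rep i)
      ((Set.Finite.pi' fun _ : Fin 3 => hS).subset ?_) ?_
    · rintro _ ⟨P, ⟨rfl, hPF, hPG⟩, rfl⟩ k
      by_cases hk : k = chartIndex P
      · refine Or.inl ?_
        simp only [hk]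
        exact div_self (rep_chartIndex_ne_zero P)
      · obtain ⟨j, rfl⟩ := Fin.exists_succAbove_eq hk
        refine Or.inr (Set.mem_iUnion.2 ⟨j, ?_⟩)
        have := hmem j ℂ (fun k => P.rep k / P.rep (chartIndex P))
          (div_self (rep_chartIndex_ne_zero P))
        rw [constantCoeff_dehomogenize, ← coe_aeval_eq_eval] at hPF hPG
        simp only [RingHom.coe_coe] at hPF hPG
        rw [hPF, hPG, Ideal.mem_span_pair] at this
        obtain ⟨a, b, hab⟩ := this
        rw [mul_zero, mul_zero, add_zero] at hab
        exact hab.symm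
    · rintro P ⟨rfl, -⟩ P' ⟨hi, -⟩ heq
      have h0 := rep_chartIndex_ne_zero P
      have h0' := rep_chartIndex_ne_zero P'
      rw [hi] at h0'
      rw [← P.mk_rep, ← P'.mk_rep, Projectivization.mk_eq_mk_iff']
      refine ⟨P.rep (chartIndex P) / P'.rep (chartIndex P), ?_⟩
      funext k
      have := congrFun heq k
      simp only [Pi.smul_apply, smul_eq_mul] at this ⊢
      field_simp at this ⊢
      linear_combination -this
  refine (Set.finite_iUnion h1).subset fun P hP => Set.mem_iUnion.2 ⟨chartIndex P, rfl, hP⟩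

/-! ### Generic members of a pencil -/

/-- Two distinct parameters have a non-zero determinant, so two vanishing combinations would force
`u = v = 0`. -/
theorem subsingleton_rep_smul_eq_zero {M : Type*} [AddCommGroup M] [Module ℂ M] {u v : M}
    (h : u ≠ 0 ∨ v ≠ 0) : {p : CP1 | p.rep 0 • u + p.rep 1 • v = 0}.Subsingleton := by
  intro p hp p' hp'
  refine rep_div_injective ?_
  simp only [Set.mem_ofPred_eq] at hp hp'
  have h1 : (p.rep 0 * p'.rep 1 - p'.rep 0 * p.rep 1) • u = 0 := by
    have : (p.rep 0 * p'.rep 1 - p'.rep 0 * p.rep 1) • u =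
        p'.rep 1 • (p.rep 0 • u + p.rep 1 • v) - p.rep 1 • (p'.rep 0 • u + p'.rep 1 • v) := by
      module
    rw [this, hp, hp', smul_zero, smul_zero, sub_zero]
  have h2 : (p.rep 0 * p'.rep 1 - p'.rep 0 * p.rep 1) • v = 0 := by
    have : (p.rep 0 * p'.rep 1 - p'.rep 0 * p.rep 1) • v =
        p.rep 0 • (p'.rep 0 • u + p'.rep 1 • v) - p'.rep 0 • (p.rep 0 • u + p.rep 1 • v) := by
      module
    rw [this, hp, hp', smul_zero, smul_zero, sub_zero]
  rw [← sub_eq_zero]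
  rcases h with h | h
  · exact (smul_eq_zero.1 h1).resolve_right h
  · exact (smul_eq_zero.1 h2).resolve_right h

theorem eventually_rep_smul_ne_zero {M : Type*} [AddCommGroup M] [Module ℂ M] {u v : M}
    (h : u ≠ 0 ∨ v ≠ 0) : ∀ᶠ p : CP1 in cofinite, p.rep 0 • u + p.rep 1 • v ≠ 0 := by
  rw [eventually_cofinite]
  simp only [not_not]
  exact (subsingleton_rep_smul_eq_zero h).finite

/-- Makes the cofinite filter on parameters non-trivial, so that properties of the generic members
have a common witness. -/
instance : Infinite CP1 := by
  have hne : ∀ t : ℂ, ![1, t] ≠ 0 := fun t h => one_ne_zero (congrFun h 0)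
  refine Infinite.of_injective (fun t : ℂ => Projectivization.mk ℂ ![1, t] (hne t)) fun s t h => ?_
  obtain ⟨a, ha⟩ := (Projectivization.mk_eq_mk_iff' ℂ _ _ _ _).1 h
  have h0 := congrFun ha 0
  have h1 := congrFun ha 1
  simp at h0 h1
  rw [← h1, h0, one_mul]

/-! ### Virtual transforms of a pencil along blow-ups -/

section Pencil

variable (F₁ F₂ : MvPolynomial (Fin 3) ℂ)

/-- The strict transforms of the generic members at a point are the corresponding combinations of
the virtual transforms of the generators, which are linearly independent, span an ideal of finite
colength, and define the strict transform of the vector field of the pencil. -/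
structure IsAdapted (Q : Point) : Prop where
  indep : Indep (virtualCurve F₁ F₂ F₁ Q) (virtualCurve F₁ F₂ F₂ Q)
  wronskian : ∃ h, ∀ i, wronskian (virtualCurve F₁ F₂ F₁ Q) (virtualCurve F₁ F₂ F₂ Q) i =
    h * strictForm (pencilForm F₁ F₂) Q i
  colength : colength (virtualCurve F₁ F₂ F₁ Q) (virtualCurve F₁ F₂ F₂ Q) ≠ ⊤
  member : ∀ᶠ p : CP1 in cofinite, strictCurve (member F₁ F₂ p) Q =
    C (p.rep 0) * virtualCurve F₁ F₂ F₁ Q + C (p.rep 1) * virtualCurve F₁ F₂ F₂ Q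

variable {F₁ F₂}

theorem Indep.exists_ord {f g : LocalPoly} (h : Indep f g) : ∃ m, f ∈ ord m ∧ g ∈ ord m ∧
    (homogeneousComponent m f ≠ 0 ∨ homogeneousComponent m g ≠ 0) := by
  classical
  have hf : f ≠ 0 := by rintro rfl; exact one_ne_zero (h 1 0 (by simp)).1
  have hex : ∃ m, homogeneousComponent m f ≠ 0 ∨ homogeneousComponent m g ≠ 0 := by
    obtain ⟨k, hk⟩ := exists_homogeneousComponent_ne_zero hf
    exact ⟨k, Or.inl hk⟩
  refine ⟨Nat.find hex, fun j hj => ?_, fun j hj => ?_, Nat.find_spec hex⟩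
  · have := Nat.find_min hex hj
    push Not at this
    exact this.1
  · have := Nat.find_min hex hj
    push Not at this
    exact this.2

theorem IsAdapted.eventually_mult_eq {Q : Point} (hQ : IsAdapted F₁ F₂ Q) {m : ℕ}
    (hf : virtualCurve F₁ F₂ F₁ Q ∈ ord m) (hg : virtualCurve F₁ F₂ F₂ Q ∈ ord m)
    (hm : homogeneousComponent m (virtualCurve F₁ F₂ F₁ Q) ≠ 0 ∨
      homogeneousComponent m (virtualCurve F₁ F₂ F₂ Q) ≠ 0) :
    ∀ᶠ p : CP1 in cofinite, mult (strictCurve (InfNear.member F₁ F₂ p) Q) = m := by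
  filter_upwards [hQ.member, eventually_rep_smul_ne_zero hm] with p hp hne
  rw [hp, C_mul', C_mul']
  refine mult_eq (add_mem (Submodule.smul_mem _ _ hf) (Submodule.smul_mem _ _ hg)) ?_
  rwa [map_add, map_smul, map_smul]

theorem IsAdapted.pencilMult_eq {Q : Point} (hQ : IsAdapted F₁ F₂ Q) {m : ℕ}
    (hf : virtualCurve F₁ F₂ F₁ Q ∈ ord m) (hg : virtualCurve F₁ F₂ F₂ Q ∈ ord m)
    (hm : homogeneousComponent m (virtualCurve F₁ F₂ F₁ Q) ≠ 0 ∨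
      homogeneousComponent m (virtualCurve F₁ F₂ F₂ Q) ≠ 0) : pencilMult F₁ F₂ Q = m := by
  have h1 := hQ.eventually_mult_eq hf hg hm
  have h2 := Classical.epsilon_spec (p := fun m : ℕ =>
    ∀ᶠ p : CP1 in cofinite, mult (strictCurve (InfNear.member F₁ F₂ p) Q) = m) ⟨m, h1⟩
  obtain ⟨p, hp1, hp2⟩ := (h1.and h2).exists
  exact hp2.symm.trans hp1

theorem IsAdapted.pencilMult_spec {Q : Point} (hQ : IsAdapted F₁ F₂ Q) :
    virtualCurve F₁ F₂ F₁ Q ∈ ord (pencilMult F₁ F₂ Q) ∧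
    virtualCurve F₁ F₂ F₂ Q ∈ ord (pencilMult F₁ F₂ Q) ∧
    (homogeneousComponent (pencilMult F₁ F₂ Q) (virtualCurve F₁ F₂ F₁ Q) ≠ 0 ∨
      homogeneousComponent (pencilMult F₁ F₂ Q) (virtualCurve F₁ F₂ F₂ Q) ≠ 0) := by
  obtain ⟨m, hf, hg, hm⟩ := hQ.indep.exists_ord
  rw [hQ.pencilMult_eq hf hg hm]
  exact ⟨hf, hg, hm⟩

theorem virtualCurve_near (F : MvPolynomial (Fin 3) ℂ) (Q : Point) (d : CP1) :
    virtualCurve F₁ F₂ F (.near Q d) =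
      transform d (pencilMult F₁ F₂ Q) (virtualCurve F₁ F₂ F Q) := rfl

theorem strictCurve_near (F : MvPolynomial (Fin 3) ℂ) (Q : Point) (d : CP1) :
    strictCurve F (.near Q d) = transform d (mult (strictCurve F Q)) (strictCurve F Q) := rfl

theorem IsAdapted.colength_near_add_le {Q : Point} (hQ : IsAdapted F₁ F₂ Q) (d : CP1) :
    InfNear.colength (virtualCurve F₁ F₂ F₁ (.near Q d)) (virtualCurve F₁ F₂ F₂ (.near Q d)) +
      (pencilMult F₁ F₂ Q ^ 2 : ℕ) ≤
    InfNear.colength (virtualCurve F₁ F₂ F₁ Q) (virtualCurve F₁ F₂ F₂ Q) := by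
  obtain ⟨hf, hg, hm⟩ := hQ.pencilMult_spec
  exact colength_transform_add_le d hf hg hm

/-- Virtual and strict transforms keep agreeing because the generic members have multiplicity
exactly `pencilMult F₁ F₂ Q`, so both are divided by the same power of the exceptional equation. -/
theorem IsAdapted.near {Q : Point} (hQ : IsAdapted F₁ F₂ Q) (d : CP1) :
    IsAdapted F₁ F₂ (.near Q d) := by
  obtain ⟨hf, hg, hm⟩ := hQ.pencilMult_spec
  obtain ⟨h, hW⟩ := hQ.wronskian
  refine ⟨hQ.indep.transform d hf hg, exists_wronskian_transform_eq d hf hg hm hQ.indep hW,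
    ne_top_of_le_ne_top hQ.colength (le_self_add.trans (hQ.colength_near_add_le d)), ?_⟩
  filter_upwards [hQ.member, hQ.eventually_mult_eq hf hg hm] with p hp hmult
  rw [strictCurve_near, hmult, hp, transform_add, transform_C_mul, transform_C_mul]
  rfl

theorem isAdapted {n : ℕ} (hn : 0 < n) (hF₁ : F₁.IsHomogeneous n) (hF₂ : F₂.IsHomogeneous n)
    (hF : IsRelPrime F₁ F₂) (Q : Point) : IsAdapted F₁ F₂ Q := by
  induction Q with
  | proper P =>
    refine ⟨(indep_of_isRelPrime hn hF₁ hF₂ hF).dehomogenize hF₁ hF₂ P,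
      ⟨_, wronskian_dehomogenize F₁ F₂ P⟩, colength_dehomogenize_ne_top hF₁ hF₂ hF P,
      Eventually.of_forall fun p => ?_⟩
    simp only [strictCurve, virtualCurve, member, dehomogenize_eq, map_add, map_mul, bind₁_C_right]
  | near Q d ih => exact ih.near d

theorem IsAdapted.mem_basePoints_iff {Q : Point} (hQ : IsAdapted F₁ F₂ Q) :
    Q ∈ basePoints F₁ F₂ ↔ constantCoeff (virtualCurve F₁ F₂ F₁ Q) = 0 ∧
      constantCoeff (virtualCurve F₁ F₂ F₂ Q) = 0 := by
  constructor
  · intro (h : ∀ᶠ p : CP1 in cofinite, constantCoeff (strictCurve (InfNear.member F₁ F₂ p) Q) = 0)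
    by_contra hne
    rw [not_and_or] at hne
    obtain ⟨p, hp1, hp2, hp3⟩ :=
      (h.and (hQ.member.and (eventually_rep_smul_ne_zero hne))).exists
    rw [hp2] at hp1
    simp at hp1
    exact hp3 hp1
  · rintro ⟨h1, h2⟩
    change ∀ᶠ p : CP1 in cofinite, _
    filter_upwards [hQ.member] with p hp
    rw [hp]
    simp [h1, h2]

theorem IsAdapted.mem_basePoints_iff_pos {Q : Point} (hQ : IsAdapted F₁ F₂ Q) :
    Q ∈ basePoints F₁ F₂ ↔ 0 < pencilMult F₁ F₂ Q := by
  obtain ⟨hf, hg, hm⟩ := hQ.pencilMult_spec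
  rw [hQ.mem_basePoints_iff]
  constructor
  · rintro ⟨h1, h2⟩
    rw [Nat.pos_iff_ne_zero]
    intro h0
    rw [h0, Ne, Ne, homogeneousComponent_zero_eq_zero_iff, homogeneousComponent_zero_eq_zero_iff,
      h1, h2] at hm
    simp at hm
  · intro h
    exact ⟨constantCoeff_eq_zero_of_mem_ord (ord_anti h hf),
      constantCoeff_eq_zero_of_mem_ord (ord_anti h hg)⟩

theorem IsAdapted.near_mem_basePoints_iff {Q : Point} (hQ : IsAdapted F₁ F₂ Q) (d : CP1) :
    Point.near Q d ∈ basePoints F₁ F₂ ↔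
      eval d.rep (homogeneousComponent (pencilMult F₁ F₂ Q) (virtualCurve F₁ F₂ F₁ Q)) = 0 ∧
      eval d.rep (homogeneousComponent (pencilMult F₁ F₂ Q) (virtualCurve F₁ F₂ F₂ Q)) = 0 := by
  obtain ⟨hf, hg, hm⟩ := hQ.pencilMult_spec
  rw [(hQ.near d).mem_basePoints_iff, virtualCurve_near, virtualCurve_near,
    constantCoeff_transform_eq_zero_iff d hf, constantCoeff_transform_eq_zero_iff d hg]

theorem IsAdapted.mem_basePoints_of_near {Q : Point} (hQ : IsAdapted F₁ F₂ Q) {d : CP1}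
    (h : Point.near Q d ∈ basePoints F₁ F₂) : Q ∈ basePoints F₁ F₂ := by
  obtain ⟨hf, hg, hm⟩ := hQ.pencilMult_spec
  rw [hQ.near_mem_basePoints_iff] at h
  rw [hQ.mem_basePoints_iff_pos, Nat.pos_iff_ne_zero]
  intro h0
  -- In multiplicity `0` the leading forms are constants, not both zero, and have no common zero.
  simp only [h0, homogeneousComponent_zero, eval_C] at h hm
  simp [h.1, h.2] at hm

theorem IsAdapted.finite_near {Q : Point} (hQ : IsAdapted F₁ F₂ Q) :
    {d : CP1 | Point.near Q d ∈ basePoints F₁ F₂}.Finite := by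
  obtain ⟨hf, hg, hm⟩ := hQ.pencilMult_spec
  rcases hm with hm | hm
  · exact (finite_eval_rep_eq_zero (homogeneousComponent_isHomogeneous _ _) hm).subset
      fun d hd => ((hQ.near_mem_basePoints_iff d).1 hd).1
  · exact (finite_eval_rep_eq_zero (homogeneousComponent_isHomogeneous _ _) hm).subset
      fun d hd => ((hQ.near_mem_basePoints_iff d).1 hd).2

theorem IsAdapted.charPoly_eq_zero_iff {Q : Point} (hQ : IsAdapted F₁ F₂ Q) :
    charPoly (strictForm (pencilForm F₁ F₂) Q) = 0 ↔ IsPencilDicritical F₁ F₂ Q := by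
  obtain ⟨hf, hg, hm⟩ := hQ.pencilMult_spec
  obtain ⟨h, hW⟩ := hQ.wronskian
  rw [InfNear.charPoly_eq_zero_iff hf hg hm hQ.indep hW, IsPencilDicritical,
    totalDegree_pgcd_lt_iff (homogeneousComponent_isHomogeneous _ _)
      (homogeneousComponent_isHomogeneous _ _) hm]

theorem IsAdapted.mem_basePoints_of_charPoly {Q : Point} (hQ : IsAdapted F₁ F₂ Q)
    (h : charPoly (strictForm (pencilForm F₁ F₂) Q) = 0) : Q ∈ basePoints F₁ F₂ := by
  rw [hQ.charPoly_eq_zero_iff] at h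
  exact hQ.mem_basePoints_iff_pos.2 (Nat.zero_lt_of_lt h)

end Pencil

/-! ### Infinitely near points -/

theorem IsInfNear.trans {P Q R : Point} (h : IsInfNear P Q) (h' : IsInfNear Q R) :
    IsInfNear P R := by
  induction h' with
  | refl => exact h
  | step R d _ ih => exact ih.step R d

theorem IsInfNear.eq_or_exists {P Q : Point} (h : IsInfNear P Q) :
    Q = P ∨ ∃ d, IsInfNear (.near P d) Q := by
  induction h with
  | refl => exact Or.inl rfl
  | step R d _ ih =>
    rcases ih with rfl | ⟨e, he⟩
    · exact Or.inr ⟨d, .refl⟩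
    · exact Or.inr ⟨e, he.step R d⟩

theorem exists_proper_isInfNear (Q : Point) : ∃ P, IsInfNear (.proper P) Q := by
  induction Q with
  | proper P => exact ⟨P, .refl⟩
  | near Q d ih =>
    obtain ⟨P, hP⟩ := ih
    exact ⟨P, hP.step Q d⟩

theorem IsInfNear.not_isOrdinary {Ω : HomForm} {P Q : Point} (h : IsInfNear P Q)
    (hP : ¬ IsOrdinary (strictForm Ω P)) : ¬ IsOrdinary (strictForm Ω Q) := by
  induction h with
  | refl => exact hP
  | step R d _ ih => exact not_isOrdinary_blowUpForm d ih

/-! ### Base points and the dicritical configuration -/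

section Pencil

variable {F₁ F₂ : MvPolynomial (Fin 3) ℂ} (H : ∀ Q, IsAdapted F₁ F₂ Q)
include H

theorem IsInfNear.mem_basePoints {P Q : Point} (h : IsInfNear P Q) (hQ : Q ∈ basePoints F₁ F₂) :
    P ∈ basePoints F₁ F₂ := by
  induction h with
  | refl => exact hQ
  | step R d _ ih => exact ih ((H R).mem_basePoints_of_near hQ)

/-- The descent behind both inductions below: a base point has positive multiplicity, so Noether's
inequality lowers the colength strictly. -/
theorem colength_near_lt {Q : Point} (hQ : Q ∈ basePoints F₁ F₂) (d : CP1) {N : ℕ}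
    (hN : colength (virtualCurve F₁ F₂ F₁ Q) (virtualCurve F₁ F₂ F₂ Q) < (N + 1 : ℕ)) :
    colength (virtualCurve F₁ F₂ F₁ (.near Q d)) (virtualCurve F₁ F₂ F₂ (.near Q d)) < N := by
  have h1 := (H Q).colength_near_add_le d
  have h2 := (H Q).mem_basePoints_iff_pos.1 hQ
  have h3 := h1.trans_lt hN
  generalize colength (virtualCurve F₁ F₂ F₁ (.near Q d)) (virtualCurve F₁ F₂ F₂ (.near Q d)) = A
    at *
  have hA : A ≠ ⊤ := by
    rintro rfl
    rw [top_add] at h3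
    exact not_top_lt h3
  lift A to ℕ using hA
  norm_cast at h3 ⊢
  have : 0 < pencilMult F₁ F₂ Q ^ 2 := by positivity
  omega

theorem finite_infNear_basePoints {Q : Point} (hQ : Q ∈ basePoints F₁ F₂) :
    {R | R ∈ basePoints F₁ F₂ ∧ IsInfNear Q R}.Finite := by
  obtain ⟨D, hD⟩ := ENat.ne_top_iff_exists.1 (H Q).colength
  suffices h : ∀ (N : ℕ) (Q : Point), Q ∈ basePoints F₁ F₂ →
      colength (virtualCurve F₁ F₂ F₁ Q) (virtualCurve F₁ F₂ F₂ Q) < N →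
      {R | R ∈ basePoints F₁ F₂ ∧ IsInfNear Q R}.Finite by
    refine h (D + 1) Q hQ ?_
    rw [← hD]
    exact_mod_cast Nat.lt_succ_self D
  intro N
  induction N with
  | zero => intro Q _ h; simp at h
  | succ N ih =>
    intro Q hQ hN
    have hfin : (⋃ d ∈ {d | Point.near Q d ∈ basePoints F₁ F₂},
        {R | R ∈ basePoints F₁ F₂ ∧ IsInfNear (.near Q d) R}).Finite :=
      (H Q).finite_near.biUnion fun d hd => ih _ hd (colength_near_lt H hQ d hN)
    refine ((Set.finite_singleton Q).union hfin).subset ?_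
    rintro R ⟨hR, hQR⟩
    rcases hQR.eq_or_exists with rfl | ⟨d, hd⟩
    · exact Or.inl rfl
    · exact Or.inr (Set.mem_biUnion (hd.mem_basePoints H hR : Point.near Q d ∈ _) ⟨hR, hd⟩)

/-- Some dicritical singularity of the vector field is infinitely near to each base point. -/
theorem exists_isInfNear_charPoly_eq_zero {Q : Point} (hQ : Q ∈ basePoints F₁ F₂) :
    ∃ R, IsInfNear Q R ∧ charPoly (strictForm (pencilForm F₁ F₂) R) = 0 := by
  obtain ⟨D, hD⟩ := ENat.ne_top_iff_exists.1 (H Q).colength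
  suffices h : ∀ (N : ℕ) (Q : Point), Q ∈ basePoints F₁ F₂ →
      colength (virtualCurve F₁ F₂ F₁ Q) (virtualCurve F₁ F₂ F₂ Q) < N →
      ∃ R, IsInfNear Q R ∧ charPoly (strictForm (pencilForm F₁ F₂) R) = 0 by
    refine h (D + 1) Q hQ ?_
    rw [← hD]
    exact_mod_cast Nat.lt_succ_self D
  intro N
  induction N with
  | zero => intro Q _ h; simp at h
  | succ N ih =>
    intro Q hQ hN
    by_cases hc : charPoly (strictForm (pencilForm F₁ F₂) Q) = 0
    · exact ⟨Q, .refl, hc⟩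
    · obtain ⟨hf, hg, hm⟩ := (H Q).pencilMult_spec
      rw [(H Q).charPoly_eq_zero_iff, IsPencilDicritical,
        totalDegree_pgcd_lt_iff (homogeneousComponent_isHomogeneous _ _)
          (homogeneousComponent_isHomogeneous _ _) hm] at hc
      -- At a non-dicritical base point the leading forms are proportional and of positive degree; a
      -- common zero is a base point on the exceptional divisor.
      obtain ⟨d, hd⟩ := exists_common_zero (homogeneousComponent_isHomogeneous _ _)
        (homogeneousComponent_isHomogeneous _ _) ((H Q).mem_basePoints_iff_pos.1 hQ) hc
      obtain ⟨R, hR, hR'⟩ := ih _ (((H Q).near_mem_basePoints_iff d).2 hd)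
        (colength_near_lt H hQ d hN)
      exact ⟨R, (IsInfNear.step Q d .refl).trans hR, hR'⟩

/-- A non-ordinary point has only non-ordinary points infinitely near to it, whereas a base point
precedes a dicritical, hence ordinary, singularity. -/
theorem isOrdinary_of_mem_basePoints {Q : Point} (hQ : Q ∈ basePoints F₁ F₂) :
    IsOrdinary (strictForm (pencilForm F₁ F₂) Q) := by
  obtain ⟨R, hQR, hR⟩ := exists_isInfNear_charPoly_eq_zero H hQ
  by_contra h
  exact hQR.not_isOrdinary h (isOrdinary_of_charPoly_eq_zero hR)

theorem basePoints_subset_singularConfiguration :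
    basePoints F₁ F₂ ⊆ singularConfiguration (pencilForm F₁ F₂) := by
  intro Q hQ
  obtain ⟨P, hP⟩ := exists_proper_isInfNear Q
  exact ⟨isOrdinary_of_mem_basePoints H hQ, P,
    isOrdinary_of_mem_basePoints H (hP.mem_basePoints H hQ), hP⟩

theorem basePoints_eq_dicriticalConfiguration :
    basePoints F₁ F₂ = dicriticalConfiguration (pencilForm F₁ F₂) := by
  ext P
  constructor
  · intro hP
    obtain ⟨R, hPR, hR⟩ := exists_isInfNear_charPoly_eq_zero H hP
    exact ⟨basePoints_subset_singularConfiguration H hP, R,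
      basePoints_subset_singularConfiguration H ((H R).mem_basePoints_of_charPoly hR), hPR,
      isSingular_of_charPoly_eq_zero hR, hR⟩
  · rintro ⟨-, Q, -, hPQ, -, hQ⟩
    exact hPQ.mem_basePoints H ((H Q).mem_basePoints_of_charPoly hQ)

end Pencil

end

end InfNear

theorem mainTheorem5 (n : ℕ) (hn : 0 < n) (F₁ F₂ : MvPolynomial (Fin 3) ℂ)
    (hF₁ : F₁.IsHomogeneous n) (hF₂ : F₂.IsHomogeneous n) (hF : IsRelPrime F₁ F₂) :
    InfNear.IsConfiguration (InfNear.basePoints F₁ F₂) ∧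
    InfNear.basePoints F₁ F₂ =
      InfNear.dicriticalConfiguration (InfNear.pencilForm F₁ F₂) ∧
    ∀ P ∈ InfNear.basePoints F₁ F₂,
      (InfNear.IsPencilDicritical F₁ F₂ P ↔
        P ∈ InfNear.dicriticalSingularities (InfNear.pencilForm F₁ F₂)) := by
  have H := InfNear.isAdapted hn hF₁ hF₂ hF
  have heq := InfNear.basePoints_eq_dicriticalConfiguration H
  refine ⟨⟨?_, fun Q d h => (H Q).mem_basePoints_of_near h⟩, heq, fun P hP => ?_⟩
  -- Base points are sorted by the proper point that they lie over. That point is itself a base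
  -- point, so a common zero of `F₁` and `F₂`.
  · refine ((InfNear.finite_common_zeros hF₁ hF₂ hF).biUnion
      (t := fun P => {R | R ∈ InfNear.basePoints F₁ F₂ ∧ InfNear.IsInfNear (.proper P) R ∧
        .proper P ∈ InfNear.basePoints F₁ F₂}) fun P _ => ?_).subset fun Q hQ => ?_
    · by_cases hP : .proper P ∈ InfNear.basePoints F₁ F₂
      · exact (InfNear.finite_infNear_basePoints H hP).subset fun R hR => ⟨hR.1, hR.2.1⟩
      · exact Set.finite_empty.subset fun R hR => hP hR.2.2
    · obtain ⟨P, hP⟩ := InfNear.exists_proper_isInfNear Q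
      have h := hP.mem_basePoints H hQ
      exact Set.mem_biUnion ((H _).mem_basePoints_iff.1 h) ⟨hQ, hP, h⟩
  · rw [← (H P).charPoly_eq_zero_iff]
    exact ⟨fun h => ⟨heq ▸ hP, InfNear.isSingular_of_charPoly_eq_zero h, h⟩, fun h => h.2.2⟩
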